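/- Let $K$ be a field. A graded filtered Floer--Novikov complex $\mathfrak c=(\pi\colon P\to S,\mathcal A,\omega,gr,deg,\partial)$ over $K$ consists of: a principal $\Gamma$-bundle $\pi\colon P\to S$ (a surjection whose fibres are the orbits of a free action of $\Gamma$ on $P$), where $\Gamma$ is a finitely generated abelian group and $S$ is a finite set; functions $\mathcal A\colon P\to\mathbb R$, $gr\colon P\to\mathbb Z$ and homomorphisms $\omega\colon\Gamma\to\mathbb R$, $deg\colon\Gamma\to\mathbb Z$ with $\mathcal A(g\cdot p)=\mathcal A(p)-\omega(g)$ and $gr(g\cdot p)=gr(p)-deg(g)$; and a boundary operator $\partial$ as follows. Let $C_k=C_k(\mathfrak c)$ be the space of formal sums $\sum_{gr(p)=k}a_p\,p$ with $a_p\in K$ such that $\{p : a_p\ne0,\ \mathcal A(p)>C\}$ is finite for every $C\in\mathbb R$, let $C_*=\bigoplus_k C_k$, and let $\bar\Lambda$ be the Novikov ring of formal sums $\sum_{g\in\Gamma}b_g\,g$, $b_g\in K$, that involve only finitely many values of $deg$ and for which $\{g : b_g\neq0,\ \omega(g)<C\}$ is finite for every $C\in\mathbb R$; it acts on $C_*$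 by extending the action of $\Gamma$ on $P$. Put $\ell(\sum a_p\,p)=\max\{\mathcal A(p) : a_p\ne 0\}$ and $\ell(0)=-\infty$. Then $\partial\colon C_*\to C_*$ is a $\bar\Lambda$-module endomorphism with $\partial^2=0$, $\partial(C_k)\subset C_{k-1}$, and $\ell(\partial c)<\ell(c)$ for all $c\neq0$. Write $\partial p=\sum_q n(p,q)\,q$. The opposite complex $\mathfrak c^{op}$ has the same $\pi$, $\omega$ and $deg$, the action $g\cdot^{op}p=g^{-1}\cdot p$, $\mathcal A^{op}=-\mathcal A$, $gr^{op}=-gr$, and the boundary operator $\delta$ with $\delta p=\sum_q n(q,p)\,q$, that is, $\delta\big(\sum_p d_p\,p\big)=\sum_q\big(\sum_p d_p\,n(q,p)\big)\,q$; it is again a graded filtered Floer--Novikov complex. Let $D_*=C_*(\mathfrak c^{op})$, let $\ell^{op}$ be its filtration level, and define $\Delta\colon D_*\times C_*\to K$ by $\Delta(\sum d_p\,p,\sum c_q\,q)=\sum_p d_pc_p$. For $k\in\mathbb Z$ the linking form $\lambda\colon\delta(D_{-k+1})\times\partial(C_k)\to K$ is $\lambda(x,y)=\Delta(x,c)$ for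 any $c\in C_k$ with $\partial c=y$; this does not depend on the choice of $c$. The boundary depth is $$\beta_k(\mathfrak c)=\inf\Big\{\beta\in[0,\infty) : \forall\gamma\in\mathbb R,\ \partial(C_{k+1})\cap\{c\in C_k : \ell(c)<\gamma\}\subset\partial\big(\{c\in C_{k+1} : \ell(c)<\gamma+\beta\}\big)\Big\}.$$ Assume that $\omega$ is injective on $\ker(deg)$. Then for every $k\in\mathbb Z$ the boundary depth $\beta_{k-1}(\mathfrak c)$ is finite, and $$\beta_{k-1}(\mathfrak c)=\beta_{-k}(\mathfrak c^{op})=-\inf\big(\{0\}\cup\{\ell(y)+\ell^{op}(x) : x\in\delta(D_{-k+1}),\ y\in\partial(C_k),\ \lambda(x,y)\neq0\}\big).$$ -/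

import Mathlib

namespace FloerNovikov

open Classical in
/-- The function `P → K` which is `1` at `p` and `0` elsewhere. -/
noncomputable def indicatorOne {K X : Type*} [Field K] (x : X) : X → K :=
  fun y => if y = x then 1 else 0

/-- The geometric part of a graded filtered Floer-Novikov complex: a principal `Γ`-bundle
`proj : P → S` (the left action of `g` on `P` is the permutation `act g`), the action functional
`A`, the period homomorphism `ω`, the grading `gr` and the degree homomorphism `deg`. -/
structure Base (Γ P S : Type*) [CommGroup Γ] where
  proj : P → S
  act : Γ →* Equiv.Perm P
  proj_surjective : Function.Surjective proj
  proj_eq_iff : ∀ p q : P, proj p = proj q ↔ ∃ g : Γ, act g p = q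
  act_free : ∀ (g : Γ) (p : P), act g p = p → g = 1
  A : P → ℝ
  ω : Γ →* Multiplicative ℝ
  A_act : ∀ (g : Γ) (p : P), A (act g p) = A p - (ω g).toAdd
  gr : P → ℤ
  deg : Γ →* Multiplicative ℤ
  gr_act : ∀ (g : Γ) (p : P), gr (act g p) = gr p - (deg g).toAdd

theorem exists_ne_zero_of_finsum {K X : Type*} [Field K] {f : X → K} (h : ∑ᶠ x, f x ≠ 0) :
    ∃ x, f x ≠ 0 := by
  by_contra! h'
  exact h (by simp [h'])

theorem finsum_swap {K X Y : Type*} [Field K] (f : X → Y → K)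
    (h : {z : X × Y | f z.1 z.2 ≠ 0}.Finite) :
    ∑ᶠ x, ∑ᶠ y, f x y = ∑ᶠ y, ∑ᶠ x, f x y := by
  classical
  have hX := h.image Prod.fst
  have hY := h.image Prod.snd
  have h1 : ∀ x, ∑ᶠ y, f x y = ∑ y ∈ hY.toFinset, f x y := fun x =>
    finsum_eq_sum_of_support_subset _ fun y hy => by
      simpa using ⟨x, hy⟩
  have h2 : ∀ y, ∑ᶠ x, f x y = ∑ x ∈ hX.toFinset, f x y := fun y =>
    finsum_eq_sum_of_support_subset _ fun x hx => by
      simpa using ⟨y, hx⟩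
  rw [finsum_eq_sum_of_support_subset (s := hX.toFinset),
    finsum_eq_sum_of_support_subset (s := hY.toFinset)]
  · simp_rw [h1, h2]
    exact Finset.sum_comm
  · intro y hy
    obtain ⟨x, hx⟩ := exists_ne_zero_of_finsum hy
    simpa using ⟨x, hx⟩
  · intro x hx
    obtain ⟨y, hy⟩ := exists_ne_zero_of_finsum hx
    simpa using ⟨y, hy⟩

namespace Base

variable {K Γ P S : Type*} [Field K] [CommGroup Γ]

/-- The Floer chain complex `C_* = ⨁ₖ C_k` as a space of functions on `P`: the function `a` stands
for the formal sum `∑ a_p p`.  Only finitely many degrees occur, and above each action level there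
are only finitely many `p` with `a_p ≠ 0`. -/
def chains (B : Base Γ P S) (K : Type*) [Field K] : Submodule K (P → K) where
  carrier := {a | (∀ C : ℝ, {p | a p ≠ 0 ∧ C < B.A p}.Finite) ∧ (B.gr '' {p | a p ≠ 0}).Finite}
  zero_mem' := by simp
  add_mem' := by
    intro a b ha hb
    have key : ∀ p, (a + b) p ≠ 0 → a p ≠ 0 ∨ b p ≠ 0 := by
      intro p hp
      by_contra! h
      exact hp (by simp [h.1, h.2])
    refine ⟨fun C => ((ha.1 C).union (hb.1 C)).subset ?_, (ha.2.union hb.2).subset ?_⟩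
    · rintro p ⟨hp, hC⟩
      exact (key p hp).imp (fun h => ⟨h, hC⟩) (fun h => ⟨h, hC⟩)
    · rintro _ ⟨p, hp, rfl⟩
      exact (key p hp).imp (fun h => ⟨p, h, rfl⟩) (fun h => ⟨p, h, rfl⟩)
  smul_mem' := by
    intro t a ha
    have key : ∀ p, (t • a) p ≠ 0 → a p ≠ 0 := fun p hp h => hp (by simp [h])
    refine ⟨fun C => (ha.1 C).subset fun p hp => ⟨key p hp.1, hp.2⟩, ha.2.subset ?_⟩
    rintro _ ⟨p, hp, rfl⟩
    exact ⟨p, key p hp, rfl⟩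

/-- The degree `k` part `C_k` of `C_*`. -/
def chainsDeg (B : Base Γ P S) (K : Type*) [Field K] (k : ℤ) : Submodule K (B.chains K) where
  carrier := {a | ∀ p, a.1 p ≠ 0 → B.gr p = k}
  zero_mem' := by simp
  add_mem' := by
    intro a b ha hb p hp
    by_cases h : a.1 p = 0
    · exact hb p fun h' => hp (by simp [h, h'])
    · exact ha p h
  smul_mem' := by
    intro t a ha p hp
    exact ha p fun h => hp (by simp [h])

/-- `C_*` is the direct sum of the `C_k`. -/
theorem isInternal_chainsDeg (B : Base Γ P S) (K : Type*) [Field K] :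
    DirectSum.IsInternal fun k => B.chainsDeg K k := by
  classical
  rw [DirectSum.isInternal_submodule_iff_iSupIndep_and_iSup_eq_top]
  constructor
  · rw [iSupIndep_def]
    intro k
    rw [Submodule.disjoint_def]
    intro a ha ha'
    let Z : Submodule K (B.chains K) :=
      { carrier := {a | ∀ p, B.gr p = k → a.1 p = 0}
        zero_mem' := fun _ _ => rfl
        add_mem' := fun {x y} hx hy p hp => by
          change x.1 p + y.1 p = 0
          rw [hx p hp, hy p hp, add_zero]
        smul_mem' := fun t x hx p hp => by
          change t * x.1 p = 0
          rw [hx p hp, mul_zero] }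
    have hZ : (⨆ j, ⨆ (_ : j ≠ k), B.chainsDeg K j) ≤ Z := by
      refine iSup₂_le fun j hj x hx p hp => ?_
      by_contra hne
      exact hj ((hx p hne).symm.trans hp)
    refine Subtype.ext (funext fun p => ?_)
    by_contra hne
    exact hne (hZ ha' p (ha p hne))
  · rw [eq_top_iff]
    intro a _
    let part : ℤ → B.chains K := fun k => ⟨fun p => if B.gr p = k then a.1 p else 0, by
      have h : ∀ p, (if B.gr p = k then a.1 p else 0) ≠ 0 → a.1 p ≠ 0 := by
        intro p hp h0
        simp [h0] at hp
      refine ⟨fun C => (a.2.1 C).subset fun p hp => ⟨h p hp.1, hp.2⟩, a.2.2.subset ?_⟩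
      rintro _ ⟨p, hp, rfl⟩
      exact ⟨p, h p hp, rfl⟩⟩
    have hsum : a = ∑ k ∈ a.2.2.toFinset, part k := by
      refine Subtype.ext (funext fun p => ?_)
      rw [AddSubmonoidClass.coe_finsetSum, Finset.sum_apply]
      change _ = ∑ k ∈ a.2.2.toFinset, if B.gr p = k then a.1 p else 0
      rw [Finset.sum_ite_eq]
      split_ifs with hp
      · rfl
      · by_contra hne
        exact hp (a.2.2.mem_toFinset.2 ⟨p, hne, rfl⟩)
    rw [hsum]
    refine Submodule.sum_mem _ fun k _ => Submodule.mem_iSup_of_mem k fun p hp => ?_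
    by_contra hne
    exact hp (if_neg hne)

/-- The filtration level `ℓ (∑ a_p p) = max {A p | a_p ≠ 0}`, with `ℓ 0 = ⊥`. -/
noncomputable def level (B : Base Γ P S) (a : B.chains K) : EReal :=
  ⨆ (p : P) (_ : a.1 p ≠ 0), (B.A p : EReal)

/-- The subspace `C_k^{(-∞, α)}` of chains of degree `k` and filtration level less than `α`,
as a set. -/
def filtered (B : Base Γ P S) (K : Type*) [Field K] (k : ℤ) (α : ℝ) : Set (B.chains K) :=
  {a | a ∈ B.chainsDeg K k ∧ B.level a < (α : EReal)}

/-- The full Novikov ring `Λ̄ = ⨁ₙ eⁿ Λ`, as a space of functions on `Γ`: the function `b` stands for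
the formal sum `∑ b_g g`. Only finitely many degrees occur, and below each period there are
only finitely many `g` with `b_g ≠ 0`. -/
def novikov (B : Base Γ P S) (K : Type*) [Field K] : Submodule K (Γ → K) where
  carrier := {b | (∀ C : ℝ, {g | b g ≠ 0 ∧ (B.ω g).toAdd < C}.Finite) ∧
    ((fun g => (B.deg g).toAdd) '' {g | b g ≠ 0}).Finite}
  zero_mem' := by simp
  add_mem' := by
    intro a b ha hb
    have key : ∀ p, (a + b) p ≠ 0 → a p ≠ 0 ∨ b p ≠ 0 := by
      intro p hp
      by_contra! h
      exact hp (by simp [h.1, h.2])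
    refine ⟨fun C => ((ha.1 C).union (hb.1 C)).subset ?_, (ha.2.union hb.2).subset ?_⟩
    · rintro p ⟨hp, hC⟩
      exact (key p hp).imp (fun h => ⟨h, hC⟩) (fun h => ⟨h, hC⟩)
    · rintro _ ⟨p, hp, rfl⟩
      exact (key p hp).imp (fun h => ⟨p, h, rfl⟩) (fun h => ⟨p, h, rfl⟩)
  smul_mem' := by
    intro t a ha
    have key : ∀ p, (t • a) p ≠ 0 → a p ≠ 0 := fun p hp h => hp (by simp [h])
    refine ⟨fun C => (ha.1 C).subset fun p hp => ⟨key p hp.1, hp.2⟩, ha.2.subset ?_⟩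
    rintro _ ⟨p, hp, rfl⟩
    exact ⟨p, key p hp, rfl⟩

theorem bddAbove_of_mem (B : Base Γ P S) {a : P → K} (ha : a ∈ B.chains K) :
    ∃ M : ℝ, ∀ p, a p ≠ 0 → B.A p ≤ M := by
  obtain ⟨M, hM⟩ := ((ha.1 0).image B.A).bddAbove
  refine ⟨max M 0, fun p hp => ?_⟩
  by_cases h : 0 < B.A p
  · exact le_max_of_le_left (hM ⟨p, ⟨hp, h⟩, rfl⟩)
  · exact le_max_of_le_right (not_lt.mp h)

theorem bddBelow_of_mem (B : Base Γ P S) {b : Γ → K} (hb : b ∈ B.novikov K) :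
    ∃ m : ℝ, ∀ g, b g ≠ 0 → m ≤ (B.ω g).toAdd := by
  obtain ⟨M, hM⟩ := ((hb.1 0).image fun g => (B.ω g).toAdd).bddBelow
  refine ⟨min M 0, fun p hp => ?_⟩
  by_cases h : (B.ω p).toAdd < 0
  · exact min_le_of_left_le (hM ⟨p, ⟨hp, h⟩, rfl⟩)
  · exact min_le_of_right_le (not_lt.mp h)

theorem act_inv_act (B : Base Γ P S) (g : Γ) (p : P) : B.act g⁻¹ (B.act g p) = p := by
  rw [← Equiv.Perm.mul_apply, ← map_mul]; simp

theorem act_act_inv (B : Base Γ P S) (g : Γ) (p : P) : B.act g (B.act g⁻¹ p) = p := by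
  rw [← Equiv.Perm.mul_apply, ← map_mul]; simp

/-- The action `(∑ b_g g) · (∑ a_q q) = ∑ b_g a_q (g · q)` of `Λ̄` on `C_*`: the coefficient at `p`
is the (finite) sum of `b_g a_{g⁻¹ · p}` over `g`. -/
noncomputable def conv (B : Base Γ P S) (b : Γ → K) (a : P → K) : P → K :=
  fun p => ∑ᶠ g, b g * a (B.act g⁻¹ p)

theorem conv_mem (B : Base Γ P S) {b : Γ → K} {a : P → K} (hb : b ∈ B.novikov K)
    (ha : a ∈ B.chains K) : B.conv b a ∈ B.chains K := by
  have key : ∀ p, B.conv b a p ≠ 0 → ∃ g q, b g ≠ 0 ∧ a q ≠ 0 ∧ p = B.act g q := by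
    intro p hp
    obtain ⟨g, hg⟩ := exists_ne_zero_of_finsum hp
    exact ⟨g, B.act g⁻¹ p, left_ne_zero_of_mul hg, right_ne_zero_of_mul hg,
      (B.act_act_inv g p).symm⟩
  obtain ⟨M, hM⟩ := B.bddAbove_of_mem ha
  obtain ⟨m, hm⟩ := B.bddBelow_of_mem hb
  refine ⟨fun C => ?_, ?_⟩
  · refine (Set.Finite.image2 (fun g q => B.act g q) (hb.1 (M - C)) (ha.1 (C + m))).subset ?_
    rintro p ⟨hp, hC⟩
    obtain ⟨g, q, hg, hq, rfl⟩ := key p hp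
    rw [B.A_act] at hC
    have h1 := hM q hq
    have h2 := hm g hg
    exact ⟨g, ⟨hg, by linarith⟩, q, ⟨hq, by linarith⟩, rfl⟩
  · refine (Set.Finite.image2 (fun q g : ℤ => q - g) ha.2 hb.2).subset ?_
    rintro _ ⟨p, hp, rfl⟩
    obtain ⟨g, q, hg, hq, rfl⟩ := key p hp
    exact ⟨_, ⟨q, hq, rfl⟩, _, ⟨g, hg, rfl⟩, (B.gr_act g q).symm⟩

/-- The action of `Λ̄` on `C_*`. -/
noncomputable def novikovSMul (B : Base Γ P S) (b : B.novikov K) (a : B.chains K) : B.chains K :=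
  ⟨B.conv b.1 a.1, B.conv_mem b.2 a.2⟩

theorem indicatorOne_mem (B : Base Γ P S) (p : P) :
    (indicatorOne p : P → K) ∈ B.chains K := by
  have h : ∀ q, (indicatorOne p : P → K) q ≠ 0 → q = p := by
    intro q hq
    by_contra hne
    exact hq (by simp [indicatorOne, hne])
  refine ⟨fun C => (Set.finite_singleton p).subset fun q hq => h q hq.1,
    (Set.finite_singleton (B.gr p)).subset ?_⟩
  rintro _ ⟨q, hq, rfl⟩
  rw [h q hq]; rfl

/-- The generator `p` of `C_*`. -/
noncomputable def gen (B : Base Γ P S) (K : Type*) [Field K] (p : P) : B.chains K :=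
  ⟨indicatorOne p, B.indicatorOne_mem p⟩

/-- The opposite data: inverse action of `Γ`, negated action functional and grading,
the same `ω` and `deg`. -/
def op (B : Base Γ P S) : Base Γ P S where
  proj := B.proj
  act := B.act.comp invMonoidHom
  proj_surjective := B.proj_surjective
  proj_eq_iff p q := by
    rw [B.proj_eq_iff]
    constructor
    · rintro ⟨g, hg⟩
      exact ⟨g⁻¹, by simpa using hg⟩
    · rintro ⟨g, hg⟩
      exact ⟨g⁻¹, by simpa using hg⟩
  act_free g p h := by
    have := B.act_free g⁻¹ p h
    simpa using this
  A p := - B.A p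
  ω := B.ω
  A_act g p := by
    have := B.A_act g⁻¹ p
    rw [map_inv B.ω, toAdd_inv] at this
    change - B.A (B.act g⁻¹ p) = - B.A p - _
    rw [this]
    ring
  gr p := - B.gr p
  deg := B.deg
  gr_act g p := by
    have := B.gr_act g⁻¹ p
    rw [map_inv B.deg, toAdd_inv] at this
    change - B.gr (B.act g⁻¹ p) = - B.gr p - _
    rw [this]
    ring

/-- The pairing `Δ (∑ d_p p, ∑ c_q q) = ∑ d_p c_p` between the chains `D_*` of the opposite data
and `C_*`; the sum is finite by `pairing_finite`. -/
noncomputable def pairing (B : Base Γ P S) (d : B.op.chains K) (c : B.chains K) : K :=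
  ∑ᶠ p, d.1 p * c.1 p

theorem pairing_finite (B : Base Γ P S) {d c : P → K} (hd : d ∈ B.op.chains K)
    (hc : c ∈ B.chains K) : (Function.support fun p => d p * c p).Finite := by
  obtain ⟨M, hM⟩ := B.op.bddAbove_of_mem hd
  refine (hc.1 (- M - 1)).subset fun p hp => ⟨right_ne_zero_of_mul hp, ?_⟩
  have h : - B.A p ≤ M := hM p (left_ne_zero_of_mul hp)
  linarith

theorem pairing_add_left (B : Base Γ P S) (d d' : B.op.chains K) (c : B.chains K) :
    B.pairing (d + d') c = B.pairing d c + B.pairing d' c := by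
  unfold pairing
  rw [← finsum_add_distrib (B.pairing_finite d.2 c.2) (B.pairing_finite d'.2 c.2)]
  exact finsum_congr fun p => by simp [add_mul]

theorem pairing_smul_left (B : Base Γ P S) (t : K) (d : B.op.chains K) (c : B.chains K) :
    B.pairing (t • d) c = t * B.pairing d c := by
  unfold pairing
  rw [mul_finsum' _ _ (B.pairing_finite d.2 c.2)]
  exact finsum_congr fun p => by simp [mul_assoc]

theorem le_level (B : Base Γ P S) (a : B.chains K) {p : P} (hp : a.1 p ≠ 0) :
    (B.A p : EReal) ≤ B.level a :=
  le_iSup₂ (f := fun (p : P) (_ : a.1 p ≠ 0) => (B.A p : EReal)) p hp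

theorem level_le (B : Base Γ P S) (a : B.chains K) {C : EReal}
    (h : ∀ p, a.1 p ≠ 0 → (B.A p : EReal) ≤ C) : B.level a ≤ C :=
  iSup₂_le h

/-- The maximum in the definition of the level of a nonzero chain is attained. -/
theorem exists_level_eq (B : Base Γ P S) (a : B.chains K) (ha : a ≠ 0) :
    ∃ p, a.1 p ≠ 0 ∧ B.level a = B.A p := by
  obtain ⟨p₀, hp₀⟩ : ∃ p, a.1 p ≠ 0 := by
    by_contra! h
    exact ha (Subtype.ext (funext h))
  obtain ⟨p, hp, hmax⟩ := (a.2.1 (B.A p₀ - 1)).exists_maximalFor B.A _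
    ⟨p₀, hp₀, by linarith⟩
  refine ⟨p, hp.1, le_antisymm (B.level_le a fun q hq => ?_) (B.le_level a hp.1)⟩
  rw [EReal.coe_le_coe_iff]
  by_contra! hlt
  have h2 : q ∈ {p | a.1 p ≠ 0 ∧ B.A p₀ - 1 < B.A p} := ⟨hq, hp.2.trans hlt⟩
  exact absurd (hmax h2 hlt.le) (not_le.mpr hlt)

theorem gen_apply_ne (B : Base Γ P S) {p q : P} (h : (B.gen K p).1 q ≠ 0) : q = p := by
  by_contra hne
  exact h (by simp [gen, indicatorOne, hne])

theorem gen_apply_self (B : Base Γ P S) (p : P) : (B.gen K p).1 p = 1 := by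
  simp [gen, indicatorOne]

/-- An element of `Γ`, seen in the Novikov ring. -/
noncomputable def groupElt (B : Base Γ P S) (K : Type*) [Field K] (g : Γ) : B.novikov K := by
  refine ⟨indicatorOne g, fun C => (Set.finite_singleton g).subset ?_,
    (Set.finite_singleton (B.deg g).toAdd).subset ?_⟩
  · rintro h ⟨hh, -⟩
    by_contra hne
    exact hh (if_neg hne)
  · rintro _ ⟨h, hh, rfl⟩
    by_cases hne : h = g
    · rw [hne]; rfl
    · exact absurd (if_neg hne) hh

theorem groupElt_smul_apply (B : Base Γ P S) (g : Γ) (a : B.chains K) (p : P) :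
    (B.novikovSMul (B.groupElt K g) a).1 p = a.1 (B.act g⁻¹ p) := by
  change ∑ᶠ h, (indicatorOne g : Γ → K) h * a.1 (B.act h⁻¹ p) = _
  rw [finsum_eq_single _ g]
  · simp [indicatorOne]
  · intro h hne
    simp [indicatorOne, hne]

theorem groupElt_smul_gen (B : Base Γ P S) (g : Γ) (p : P) :
    B.novikovSMul (B.groupElt K g) (B.gen K p) = B.gen K (B.act g p) := by
  refine Subtype.ext (funext fun q => ?_)
  rw [groupElt_smul_apply]
  have h : B.act g⁻¹ q = p ↔ q = B.act g p := by
    constructor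
    · rintro rfl
      exact (B.act_act_inv g q).symm
    · rintro rfl
      exact B.act_inv_act g p
  simp only [gen, indicatorOne]
  by_cases hq : q = B.act g p
  · rw [if_pos hq, if_pos (h.2 hq)]
  · rw [if_neg hq, if_neg fun h' => hq (h.1 h')]

end Base

/-- A graded filtered Floer-Novikov complex over the field `K`: the boundary operator `bd` is a
`Λ̄`-module endomorphism of `C_*` (it is additive, in fact `K`-linear, and commutes with the action
of `Λ̄`) which squares to zero, strictly lowers the filtration level of nonzero chains and
has degree `-1`. -/
structure FloerNovikovComplex (K Γ P S : Type*) [Field K] [CommGroup Γ] [Group.FG Γ] [Finite S]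
    extends Base Γ P S where
  bd : toBase.chains K →ₗ[K] toBase.chains K
  bd_novikovSMul : ∀ (b : toBase.novikov K) (a : toBase.chains K),
    bd (toBase.novikovSMul b a) = toBase.novikovSMul b (bd a)
  bd_bd : ∀ a : toBase.chains K, bd (bd a) = 0
  level_bd_lt : ∀ a : toBase.chains K, a ≠ 0 → toBase.level (bd a) < toBase.level a
  bd_mem : ∀ (k : ℤ) (a : toBase.chains K), a ∈ toBase.chainsDeg K k →
    bd a ∈ toBase.chainsDeg K (k - 1)

namespace FloerNovikovComplex

variable {K Γ P S : Type*} [Field K] [CommGroup Γ] [Group.FG Γ] [Finite S]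

/-- The matrix of the boundary operator: `∂ p = ∑ n(p, q) q`. -/
noncomputable def n (c : FloerNovikovComplex K Γ P S) (p q : P) : K :=
  (c.bd (c.gen K p)).1 q

theorem A_lt_of_n (c : FloerNovikovComplex K Γ P S) {p q : P} (h : c.n p q ≠ 0) :
    c.A q < c.A p := by
  have hne : c.gen K p ≠ 0 := fun h0 => by
    have h1 := c.gen_apply_self (K := K) p
    rw [h0] at h1
    exact zero_ne_one h1
  have h1 := c.le_level (c.bd (c.gen K p)) h
  have h2 := c.level_le (c.gen K p) (C := (c.A p : EReal)) fun q hq => by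
    rw [c.gen_apply_ne hq]
  exact EReal.coe_lt_coe_iff.mp ((h1.trans_lt (c.level_bd_lt _ hne)).trans_le h2)

theorem gr_of_n (c : FloerNovikovComplex K Γ P S) {p q : P} (h : c.n p q ≠ 0) :
    c.gr q = c.gr p - 1 :=
  c.bd_mem (c.gr p) (c.gen K p) (fun q hq => by rw [c.gen_apply_ne hq]) q h

theorem n_act (c : FloerNovikovComplex K Γ P S) (g : Γ) (p q : P) :
    c.n (c.act g p) (c.act g q) = c.n p q := by
  unfold n
  rw [← c.groupElt_smul_gen, c.bd_novikovSMul, c.groupElt_smul_apply, c.act_inv_act]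

theorem bd_apply (c : FloerNovikovComplex K Γ P S) (a : c.chains K) (q : P) :
    (c.bd a).1 q = ∑ᶠ p, a.1 p * c.n p q := by
  classical
  set F := (a.2.1 (c.A q)).toFinset with hF
  have hmem : ∀ p, p ∈ F ↔ a.1 p ≠ 0 ∧ c.A q < c.A p := by simp [hF]
  set t : c.chains K := ∑ p ∈ F, a.1 p • c.gen K p with ht
  have ht_apply : ∀ x, t.1 x = if x ∈ F then a.1 x else 0 := by
    intro x
    have : t.1 x = ∑ p ∈ F, a.1 p * (if x = p then 1 else 0) := by
      rw [ht, AddSubmonoidClass.coe_finsetSum, Finset.sum_apply]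
      rfl
    rw [this]
    simp
  have hrest : (c.bd (a - t)).1 q = 0 := by
    by_contra hne
    have h0 : a - t ≠ 0 := by
      intro h0
      rw [h0, map_zero] at hne
      exact hne rfl
    have h1 := (c.le_level _ hne).trans_lt (c.level_bd_lt _ h0)
    have h2 : c.level (a - t) ≤ c.A q := c.level_le _ fun p hp => by
      rw [EReal.coe_le_coe_iff]
      by_contra! hlt
      have hval : (a - t).1 p = a.1 p - t.1 p := rfl
      rw [hval, ht_apply] at hp
      by_cases hpF : p ∈ F
      · simp [hpF] at hp
      · rw [if_neg hpF, sub_zero] at hp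
        exact hpF ((hmem p).2 ⟨hp, hlt⟩)
    exact absurd h1 (not_lt.mpr h2)
  have hsplit : (c.bd a).1 q = (c.bd t).1 q := by
    rw [map_sub] at hrest
    exact sub_eq_zero.mp hrest
  have htq : (c.bd t).1 q = ∑ p ∈ F, a.1 p * c.n p q := by
    rw [ht, map_sum, AddSubmonoidClass.coe_finsetSum, Finset.sum_apply]
    refine Finset.sum_congr rfl fun p _ => ?_
    rw [map_smul]; rfl
  rw [hsplit, htq, finsum_eq_sum_of_support_subset]
  intro p hp
  exact (hmem p).2 ⟨left_ne_zero_of_mul hp, c.A_lt_of_n (right_ne_zero_of_mul hp)⟩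

/-- The boundary operator `δ` of the opposite complex, given by `δ p = ∑ n(q, p) q`; that is,
`δ (∑ d_p p) = ∑_q (∑_p d_p n(q, p)) q`. -/
noncomputable def opBdFun (c : FloerNovikovComplex K Γ P S) (d : P → K) : P → K :=
  fun q => ∑ᶠ p, d p * c.n q p

theorem opBdFun_eq_pairing (c : FloerNovikovComplex K Γ P S) (d : c.op.chains K) (q : P) :
    c.opBdFun d.1 q = c.pairing d (c.bd (c.gen K q)) := rfl

theorem opBdFun_mem (c : FloerNovikovComplex K Γ P S) {d : P → K} (hd : d ∈ c.op.chains K) :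
    c.opBdFun d ∈ c.op.chains K := by
  have key : ∀ q, c.opBdFun d q ≠ 0 → ∃ p, d p ≠ 0 ∧ c.n q p ≠ 0 := by
    intro q hq
    obtain ⟨p, hp⟩ := exists_ne_zero_of_finsum hq
    exact ⟨p, left_ne_zero_of_mul hp, right_ne_zero_of_mul hp⟩
  refine ⟨fun C => ?_, ?_⟩
  · obtain ⟨rep, hrep⟩ := c.proj_surjective.hasRightInverse
    have hfin : ∀ p, {q | c.n q p ≠ 0 ∧ C < - c.A q}.Finite := by
      intro p
      have hs : ∀ s : S, {q | c.proj q = s ∧ c.n q p ≠ 0 ∧ C < - c.A q}.Finite := by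
        intro s
        have h1 := (c.bd (c.gen K (rep s))).2.1 (c.A p + c.A (rep s) + C)
        refine Set.Finite.of_finite_image
          (f := fun q => {r | ∃ g, c.act g (rep s) = q ∧ c.act g r = p})
          ((h1.image fun r => ({r} : Set P)).subset ?_) ?_
        · rintro _ ⟨q, ⟨hq, hn, hC⟩, rfl⟩
          obtain ⟨g, rfl⟩ := (c.proj_eq_iff (rep s) q).1 ((hrep s).trans hq.symm)
          refine ⟨c.act g⁻¹ p, ⟨?_, ?_⟩, ?_⟩
          · have := c.n_act g (rep s) (c.act g⁻¹ p)
            rw [c.act_act_inv] at this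
            change c.n (rep s) _ ≠ 0
            rwa [← this]
          · rw [c.A_act] at hC
            rw [c.A_act, map_inv, toAdd_inv]
            linarith
          · ext r
            simp only [Set.mem_singleton_iff, Set.mem_ofPred_eq]
            constructor
            · rintro rfl
              exact ⟨g, rfl, c.act_act_inv g p⟩
            · rintro ⟨g', h, rfl⟩
              have : g⁻¹ * g' = 1 := c.act_free _ (rep s) (by
                rw [map_mul, Equiv.Perm.mul_apply, h, c.act_inv_act])
              rw [inv_mul_eq_one.mp this, c.act_inv_act]
        · rintro q ⟨hq, -⟩ q' ⟨hq', -⟩ heq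
          obtain ⟨g, rfl⟩ := (c.proj_eq_iff (rep s) q).1 ((hrep s).trans hq.symm)
          obtain ⟨g', rfl⟩ := (c.proj_eq_iff (rep s) q').1 ((hrep s).trans hq'.symm)
          have h1 : c.act g⁻¹ p ∈ {r | ∃ h, c.act h (rep s) = c.act g' (rep s) ∧
              c.act h r = p} := by
            beta_reduce at heq
            rw [← heq]
            exact ⟨g, rfl, c.act_act_inv g p⟩
          obtain ⟨h, hh, hp⟩ := h1
          have h2 : g⁻¹ * h = 1 := by
            have h3 : h * g⁻¹ = 1 := c.act_free _ p (by
              rw [map_mul, Equiv.Perm.mul_apply, hp])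
            rwa [mul_comm]
          rw [inv_mul_eq_one.mp h2]
          exact hh
      refine (Set.finite_iUnion hs).subset fun q hq => ?_
      exact Set.mem_iUnion.2 ⟨c.proj q, rfl, hq.1, hq.2⟩
    refine ((hd.1 C).biUnion fun p _ => hfin p).subset ?_
    rintro q ⟨hq, hC⟩
    obtain ⟨p, hp, hn⟩ := key q hq
    have h1 := c.A_lt_of_n hn
    have h2 : C < - c.A q := hC
    exact Set.mem_biUnion (x := p) ⟨hp, show C < - c.A p by linarith⟩ ⟨hn, hC⟩
  · refine (hd.2.image fun k => k - 1).subset ?_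
    rintro _ ⟨q, hq, rfl⟩
    obtain ⟨p, hp, hn⟩ := key q hq
    refine ⟨_, ⟨p, hp, rfl⟩, ?_⟩
    have h1 := c.gr_of_n hn
    change - c.gr p - 1 = - c.gr q
    omega

noncomputable def opBd (c : FloerNovikovComplex K Γ P S) : c.op.chains K →ₗ[K] c.op.chains K where
  toFun d := ⟨c.opBdFun d.1, c.opBdFun_mem d.2⟩
  map_add' d d' := Subtype.ext (funext fun q => by
    change c.opBdFun (d + d').1 q = c.opBdFun d.1 q + c.opBdFun d'.1 q
    simp only [opBdFun_eq_pairing, c.pairing_add_left])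
  map_smul' t d := Subtype.ext (funext fun q => by
    change c.opBdFun (t • d).1 q = t * c.opBdFun d.1 q
    simp only [opBdFun_eq_pairing, c.pairing_smul_left])

/-- The adjunction relation `Δ (δ d, a) = Δ (d, ∂ a)`. -/
theorem pairing_opBd (c : FloerNovikovComplex K Γ P S) (d : c.op.chains K) (a : c.chains K) :
    c.pairing (c.opBd d) a = c.pairing d (c.bd a) := by
  change ∑ᶠ q, (∑ᶠ p, d.1 p * c.n q p) * a.1 q = ∑ᶠ p, d.1 p * (c.bd a).1 p
  have h1 : ∀ q, (∑ᶠ p, d.1 p * c.n q p) * a.1 q = ∑ᶠ p, d.1 p * c.n q p * a.1 q :=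
    fun q => finsum_mul _ _
  have h2 : ∀ p, d.1 p * (c.bd a).1 p = ∑ᶠ q, d.1 p * c.n q p * a.1 q := fun p => by
    rw [c.bd_apply, mul_finsum]
    exact finsum_congr fun q => by ring
  rw [finsum_congr h1, finsum_congr h2]
  refine finsum_swap _ ?_
  obtain ⟨M, hM⟩ := c.bddAbove_of_mem a.2
  obtain ⟨m, hm⟩ := c.op.bddAbove_of_mem d.2
  refine ((a.2.1 (-m)).prod (d.2.1 (-M))).subset ?_
  rintro ⟨q, p⟩ h
  have ha : a.1 q ≠ 0 := right_ne_zero_of_mul h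
  have hd : d.1 p ≠ 0 := left_ne_zero_of_mul (left_ne_zero_of_mul h)
  have hn : c.A p < c.A q := c.A_lt_of_n (right_ne_zero_of_mul (left_ne_zero_of_mul h))
  have h3 := hM q ha
  have h4 : - c.A p ≤ m := hm p hd
  exact ⟨⟨ha, by linarith⟩, hd, show -M < - c.A p by linarith⟩

/-- The opposite complex. -/
noncomputable abbrev opposite (c : FloerNovikovComplex K Γ P S) : FloerNovikovComplex K Γ P S where
  toBase := c.op
  bd := c.opBd
  bd_novikovSMul b d := by
    refine Subtype.ext (funext fun q => ?_)
    have hact : ∀ g p, c.op.act g⁻¹ p = c.act g p := fun g p => by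
      change c.act (g⁻¹)⁻¹ p = _
      rw [inv_inv]
    change ∑ᶠ p, (∑ᶠ g, b.1 g * d.1 (c.op.act g⁻¹ p)) * c.n q p =
      ∑ᶠ g, b.1 g * ∑ᶠ p, d.1 p * c.n (c.op.act g⁻¹ q) p
    simp only [hact]
    have h1 : ∀ p, (∑ᶠ g, b.1 g * d.1 (c.act g p)) * c.n q p =
        ∑ᶠ g, b.1 g * d.1 (c.act g p) * c.n q p := fun p => finsum_mul _ _
    have h2 : ∀ g, b.1 g * ∑ᶠ p, d.1 p * c.n (c.act g q) p =
        ∑ᶠ p, b.1 g * d.1 (c.act g p) * c.n q p := fun g => by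
      rw [← finsum_comp_equiv (c.act g), mul_finsum]
      exact finsum_congr fun p => by rw [c.n_act]; ring
    rw [finsum_congr h1, finsum_congr h2]
    refine finsum_swap _ ?_
    obtain ⟨m, hm⟩ := c.op.bddAbove_of_mem d.2
    obtain ⟨w, hw⟩ := c.bddBelow_of_mem b.2
    refine (Set.Finite.image (fun x : Γ × P => (c.act x.1⁻¹ x.2, x.1))
      ((b.2.1 (c.A q + m + 1)).prod (d.2.1 (w - c.A q)))).subset ?_
    rintro ⟨p, g⟩ h
    have hb : b.1 g ≠ 0 := left_ne_zero_of_mul (left_ne_zero_of_mul h)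
    have hd : d.1 (c.act g p) ≠ 0 := right_ne_zero_of_mul (left_ne_zero_of_mul h)
    have hn : c.A p < c.A q := c.A_lt_of_n (right_ne_zero_of_mul h)
    have h3 : - c.A (c.act g p) ≤ m := hm _ hd
    have h4 := hw g hb
    have h5 := c.A_act g p
    refine ⟨(g, c.act g p), ⟨⟨hb, ?_⟩, hd, ?_⟩, ?_⟩
    · change (c.ω g).toAdd < _
      linarith
    · change w - c.A q < - c.A (c.act g p)
      linarith
    · simp
  bd_bd d := by
    refine Subtype.ext (funext fun q => ?_)
    change c.pairing (c.opBd d) (c.bd (c.gen K q)) = 0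
    rw [c.pairing_opBd, c.bd_bd]
    simp [Base.pairing]
  level_bd_lt d hd := by
    by_cases h0 : c.opBd d = 0
    · rw [h0]
      obtain ⟨p, -, hp⟩ := c.op.exists_level_eq d hd
      rw [hp]
      refine lt_of_le_of_lt (c.op.level_le (K := K) 0 (C := ⊥) fun p hp => ?_)
        (EReal.bot_lt_coe _)
      exact absurd rfl hp
    · obtain ⟨q, hq, hl⟩ := c.op.exists_level_eq _ h0
      rw [hl]
      obtain ⟨p, hp⟩ := exists_ne_zero_of_finsum hq
      have h1 := c.A_lt_of_n (right_ne_zero_of_mul hp)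
      refine lt_of_lt_of_le ?_ (c.op.le_level d (left_ne_zero_of_mul hp))
      rw [EReal.coe_lt_coe_iff]
      exact neg_lt_neg h1
  bd_mem k d hd q hq := by
    obtain ⟨p, hp⟩ := exists_ne_zero_of_finsum hq
    have h1 : - c.gr p = k := hd p (left_ne_zero_of_mul hp)
    have h2 := c.gr_of_n (right_ne_zero_of_mul hp)
    change - c.gr q = k - 1
    omega

/-- The space `∂ (C_k)` of boundaries of chains of degree `k`. -/
noncomputable def boundaries (c : FloerNovikovComplex K Γ P S) (k : ℤ) :
    Submodule K (c.chains K) :=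
  (c.chainsDeg K k).map c.bd

/-- The boundary depth `β_k`: the infimum of the real `β ≥ 0` such that, for all real `γ`,
`∂ (C_{k+1}) ∩ C_k^{(-∞, γ)} ⊆ ∂ (C_{k+1}^{(-∞, γ + β)})`.  The infimum is taken in the extended
reals, so it would be `⊤` if there were no such `β`. -/
noncomputable def boundaryDepth (c : FloerNovikovComplex K Γ P S) (k : ℤ) : EReal :=
  sInf ((fun β : ℝ => (β : EReal)) '' {β : ℝ | 0 ≤ β ∧ ∀ γ : ℝ,
    (c.boundaries (k + 1) : Set (c.chains K)) ∩ c.filtered K k γ ⊆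
      c.bd '' c.filtered K (k + 1) (γ + β)})

/-- The linking form `λ : δ (D_{-k+1}) × ∂ (C_k) → K`, with `λ (x, y) = Δ (x, a)` for any
`a ∈ C_k` with `∂ a = y`. -/
noncomputable def linkingForm (c : FloerNovikovComplex K Γ P S) (k : ℤ)
    (x : c.opposite.boundaries (-k + 1)) (y : c.boundaries k) : K :=
  c.pairing x.1 (Classical.choose (Submodule.mem_map.mp y.2))

/-- The linking form does not depend on the choice made in its definition. -/
theorem linkingForm_eq (c : FloerNovikovComplex K Γ P S) (k : ℤ)
    (x : c.opposite.boundaries (-k + 1)) (y : c.boundaries k) (a : c.chains K)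
    (hy : c.bd a = y.1) : c.linkingForm k x y = c.pairing x.1 a := by
  obtain ⟨d, -, hd⟩ := Submodule.mem_map.mp x.2
  have h := (Classical.choose_spec (Submodule.mem_map.mp y.2)).2
  unfold linkingForm
  have key : ∀ e : c.chains K, c.pairing x.1 e = c.pairing d (c.bd e) := fun e => by
    rw [← hd]
    exact c.pairing_opBd d e
  rw [key, key, h, hy]

end FloerNovikovComplex

end FloerNovikov

/-! Both boundary depths are logarithms of optimal lifting constants, one for a matrix over a valued
field and one for its transpose. Since `ω` is injective on `ker deg`, it identifies this kernel with
a subgroup `G` of `ℝ`. The chains of degree `k` then form a finite-dimensional space over the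
Novikov field of `G`, with one basis vector for each fibre of `π` that meets degree `k`
(`exists_chart`). In these coordinates `exp ℓ` is a weighted maximum norm (`level_chain_le_iff`),
`∂` is a matrix `A` (`bd_chain`), and `δ` is `Aᵀ` with inverted weights (`bdMatrix_opposite`).

Eliminate by pivoting on the entry that is largest relative to the weights. By the ultrametric
inequality, clearing never enlarges norms, and a pivot of relative size `1/s` costs a factor `s` in
lifting. So the maximum `B` of `1` and all the `s` is a lifting constant for `A`, and also for `Aᵀ`,
because clearing commutes with transposition. Unless `B = 1`, the worst pivot supplies `x`, `w` with
`w ⬝ᵥ A *ᵥ x = 1` and `‖A x‖ ‖Aᵀ w‖ ≤ 1/B` (`exists_common_boundedLift`). With `B = exp b`, both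
depths are at most `b` (`boundaryDepth_le`), and `x`, `w` give a linked pair of total level at most
`-b` (`exists_linkingForm_ne_zero`).

Conversely, if `λ(x, y) ≠ 0`, every `a` with `∂ a = y` pairs nontrivially with `x`, so `ℓ(a) ≥
-ℓᵒᵖ(x)`. This bounds the depth below by `-(ℓ(y) + ℓᵒᵖ(x))` (`neg_boundaryDepth_le`); adjunction
gives the same for the opposite complex (`neg_boundaryDepth_opposite_le`). Hence `b ≤ -inf ≤` both
depths `≤ b`. -/

namespace FloerNovikov

open scoped NNReal
open Matrix

/-! ### Gaussian elimination with pivoting over a nonarchimedean valued field. -/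

section ValuedElimination

variable {F I J : Type*} [Field F]

/-- The result of clearing the row and the column of the pivot `A j₀ i₀`. -/
def clearPivot (A : Matrix J I F) (i₀ : I) (j₀ : J) : Matrix J I F :=
  Matrix.of fun j i => A j i - A j i₀ * (A j₀ i₀)⁻¹ * A j₀ i

/-- This symmetry lets a single induction treat a matrix and its transpose together. -/
theorem clearPivot_transpose (A : Matrix J I F) (i₀ : I) (j₀ : J) :
    clearPivot Aᵀ j₀ i₀ = (clearPivot A i₀ j₀)ᵀ := by
  ext i j
  simp only [clearPivot, of_apply, transpose_apply]
  ring

variable [Fintype I]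

/-- Every vector in the image of `A` has a preimage which is larger by a factor of at most `B`, for
the weighted maximum norms with weights `α` on the source and `β` on the target. -/
def BoundedLift (v : Valuation F ℝ≥0) (A : Matrix J I F) (α : I → ℝ≥0) (β : J → ℝ≥0)
    (B : ℝ≥0) : Prop :=
  ∀ x : I → F, ∃ x' : I → F, A *ᵥ x' = A *ᵥ x ∧
    ∀ C : ℝ≥0, (∀ j, β j * v ((A *ᵥ x) j) ≤ C) → ∀ i, α i * v (x' i) ≤ B * C

theorem BoundedLift.mono {v : Valuation F ℝ≥0} {A : Matrix J I F} {α : I → ℝ≥0}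
    {β : J → ℝ≥0} {B B' : ℝ≥0} (h : BoundedLift v A α β B) (hB : B ≤ B') :
    BoundedLift v A α β B' := fun x => by
  obtain ⟨x', hx', hb⟩ := h x
  exact ⟨x', hx', fun C hC i => (hb C hC i).trans (by gcongr)⟩

theorem boundedLift_zero (v : Valuation F ℝ≥0) (α : I → ℝ≥0) (β : J → ℝ≥0) (B : ℝ≥0) :
    BoundedLift v (0 : Matrix J I F) α β B :=
  fun x => ⟨0, by simp, fun C _ i => by simp⟩

theorem clearPivot_mulVec (A : Matrix J I F) (i₀ : I) (j₀ : J) (x : I → F) (j : J) :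
    (clearPivot A i₀ j₀ *ᵥ x) j =
      (A *ᵥ x) j - A j i₀ * (A j₀ i₀)⁻¹ * (A *ᵥ x) j₀ := by
  simp only [clearPivot, mulVec, dotProduct, of_apply, sub_mul, Finset.sum_sub_distrib,
    Finset.mul_sum, mul_assoc]

theorem clearPivot_mulVec_pivot (A : Matrix J I F) {i₀ : I} {j₀ : J} (h : A j₀ i₀ ≠ 0)
    (x : I → F) : (clearPivot A i₀ j₀ *ᵥ x) j₀ = 0 := by
  rw [clearPivot_mulVec, mul_inv_cancel₀ h, one_mul, sub_self]

/-- The pivot maximizes `β j * v (A j i) / α i`, the size of an entry relative to the weights; the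
inequality is cross-multiplied. -/
theorem exists_pivot [Fintype J] (v : Valuation F ℝ≥0) {A : Matrix J I F} (hA : A ≠ 0)
    {α : I → ℝ≥0} {β : J → ℝ≥0} (hα : ∀ i, 0 < α i) (hβ : ∀ j, 0 < β j) :
    ∃ i₀ j₀, A j₀ i₀ ≠ 0 ∧ ∀ j i, β j * v (A j i) * α i₀ ≤ β j₀ * v (A j₀ i₀) * α i := by
  obtain ⟨j₁, i₁, h₁⟩ : ∃ j i, A j i ≠ 0 := by
    by_contra! h
    exact hA (Matrix.ext h)
  obtain ⟨⟨j₀, i₀⟩, -, hmax⟩ := (Finset.univ : Finset (J × I)).exists_max_image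
    (fun z => β z.1 * v (A z.1 z.2) / α z.2) ⟨(j₁, i₁), Finset.mem_univ _⟩
  have hmax' : ∀ j i, β j * v (A j i) / α i ≤ β j₀ * v (A j₀ i₀) / α i₀ :=
    fun j i => hmax (j, i) (Finset.mem_univ _)
  refine ⟨i₀, j₀, fun h => ?_, fun j i => (div_le_div_iff₀ (hα i) (hα i₀)).1 (hmax' j i)⟩
  have h2 := hmax' j₁ i₁
  rw [h, map_zero, mul_zero, zero_div, nonpos_iff_eq_zero] at h2
  exact (div_pos (mul_pos (hβ j₁) (pos_iff_ne_zero.2 ((Valuation.ne_zero_iff v).2 h₁)))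
    (hα i₁)).ne' h2

variable [DecidableEq I]

theorem mulVec_add_single (A : Matrix J I F) (x : I → F) (i₀ : I) (t : F) (j : J) :
    (A *ᵥ (x + Pi.single i₀ t)) j = (A *ᵥ x) j + A j i₀ * t := by
  rw [mulVec_add, Pi.add_apply, mulVec_single]
  simp [mul_comm]

/-- Values of the cleared matrix are values of `A` itself, so witnesses for the cleared matrix can
be transported back to `A`. -/
theorem mulVec_sub_single_eq_clearPivot (A : Matrix J I F) (i₀ : I) (j₀ : J) (x : I → F) :
    A *ᵥ (x + Pi.single i₀ (-((A j₀ i₀)⁻¹ * (A *ᵥ x) j₀))) = clearPivot A i₀ j₀ *ᵥ x := by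
  ext j
  rw [mulVec_add_single, clearPivot_mulVec]
  ring

/-- The cleared matrix sends `x` to `A x` minus a multiple of the pivot column, which by maximality
of the pivot is no larger than `A x`. A lift `x'` for the cleared matrix is therefore bounded, and
changing its coordinate `i₀` repairs the pivot row. The other rows then agree automatically. -/
theorem BoundedLift.of_clearPivot {v : Valuation F ℝ≥0} {A : Matrix J I F} {α : I → ℝ≥0}
    {β : J → ℝ≥0} {B : ℝ≥0} {i₀ : I} {j₀ : J} (hα : ∀ i, 0 < α i) (hβ : ∀ j, 0 < β j)
    (h₀ : A j₀ i₀ ≠ 0)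
    (hpiv : ∀ j i, β j * v (A j i) * α i₀ ≤ β j₀ * v (A j₀ i₀) * α i)
    (hB : α i₀ ≤ B * (β j₀ * v (A j₀ i₀)))
    (h : BoundedLift v (clearPivot A i₀ j₀) α β B) : BoundedLift v A α β B := by
  intro x
  obtain ⟨x', hx', hb⟩ := h x
  have hv : 0 < v (A j₀ i₀) := by
    rw [pos_iff_ne_zero]
    exact (Valuation.ne_zero_iff v).2 h₀
  -- The unique correction that makes row `j₀` agree.
  set t := (A j₀ i₀)⁻¹ * ((A *ᵥ x) j₀ - (A *ᵥ x') j₀) with ht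
  refine ⟨x' + Pi.single i₀ t, ?_, ?_⟩
  · ext j
    have h1 := congrFun hx' j
    rw [clearPivot_mulVec, clearPivot_mulVec] at h1
    rw [mulVec_add_single, ht]
    linear_combination h1
  · intro C hC
    have h2 : ∀ i, α i * v (x' i) ≤ B * C := by
      refine hb C fun j => ?_
      rw [clearPivot_mulVec]
      have h3 : β j * v (A j i₀ * (A j₀ i₀)⁻¹ * (A *ᵥ x) j₀) ≤ C := by
        refine le_trans ?_ (hC j₀)
        have h4 : β j * v (A j i₀) ≤ β j₀ * v (A j₀ i₀) :=
          le_of_mul_le_mul_right (hpiv j i₀) (hα i₀)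
        calc β j * v (A j i₀ * (A j₀ i₀)⁻¹ * (A *ᵥ x) j₀)
            = (β j * v (A j i₀)) * (v (A j₀ i₀))⁻¹ * v ((A *ᵥ x) j₀) := by
              rw [map_mul, map_mul, map_inv₀]; ring
          _ ≤ (β j₀ * v (A j₀ i₀)) * (v (A j₀ i₀))⁻¹ * v ((A *ᵥ x) j₀) := by gcongr
          _ = β j₀ * v ((A *ᵥ x) j₀) := by rw [mul_inv_cancel_right₀ hv.ne']
      calc _ ≤ β j * max (v ((A *ᵥ x) j)) (v (A j i₀ * (A j₀ i₀)⁻¹ * (A *ᵥ x) j₀)) := by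
            gcongr
            exact v.map_sub _ _
        _ ≤ C := by
            rcases max_cases (v ((A *ᵥ x) j)) (v (A j i₀ * (A j₀ i₀)⁻¹ * (A *ᵥ x) j₀)) with
              ⟨h, -⟩ | ⟨h, -⟩ <;> rw [h]
            exacts [hC j, h3]
    -- Two terms enter `t`: the one from `A x` is controlled by `hB`, the one from `A x'` by
    -- maximality of the pivot within its row.
    have h5 : α i₀ * v t ≤ B * C := by
      have h6 : α i₀ * v ((A *ᵥ x) j₀) ≤ v (A j₀ i₀) * (B * C) := by
        calc α i₀ * v ((A *ᵥ x) j₀) ≤ B * (β j₀ * v (A j₀ i₀)) * v ((A *ᵥ x) j₀) := by gcongr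
          _ = v (A j₀ i₀) * (B * (β j₀ * v ((A *ᵥ x) j₀))) := by ring
          _ ≤ _ := by gcongr; exact hC j₀
      have h7 : α i₀ * v ((A *ᵥ x') j₀) ≤ v (A j₀ i₀) * (B * C) := by
        have h8 : v ((A *ᵥ x') j₀) ≤ v (A j₀ i₀) * (B * C) / α i₀ := by
          refine v.map_sum_le fun i _ => ?_
          rw [le_div_iff₀ (hα i₀), map_mul]
          have h9 : v (A j₀ i) * α i₀ ≤ v (A j₀ i₀) * α i := by
            refine le_of_mul_le_mul_left ?_ (hβ j₀)
            simpa only [mul_assoc] using hpiv j₀ i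
          calc v (A j₀ i) * v (x' i) * α i₀ = v (A j₀ i) * α i₀ * v (x' i) := by ring
            _ ≤ v (A j₀ i₀) * α i * v (x' i) := by gcongr
            _ = v (A j₀ i₀) * (α i * v (x' i)) := by ring
            _ ≤ _ := mul_le_mul_right (h2 i) _
        rwa [mul_comm, ← le_div_iff₀ (hα i₀)]
      have h10 : v ((A *ᵥ x) j₀ - (A *ᵥ x') j₀) ≤ v (A j₀ i₀) * (B * C) / α i₀ :=
        (v.map_sub _ _).trans (max_le ((le_div_iff₀' (hα i₀)).2 h6)
          ((le_div_iff₀' (hα i₀)).2 h7))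
      rw [le_div_iff₀' (hα i₀)] at h10
      rw [ht, map_mul, map_inv₀]
      rw [mul_left_comm]
      exact (inv_mul_le_iff₀ hv).2 h10
    intro i
    by_cases hi : i = i₀
    · subst hi
      rw [Pi.add_apply, Pi.single_eq_same]
      have h11 : v (x' i + t) ≤ B * C / α i :=
        (v.map_add _ _).trans (max_le ((le_div_iff₀' (hα i)).2 (h2 i))
          ((le_div_iff₀' (hα i)).2 h5))
      exact (le_div_iff₀' (hα i)).1 h11
    · rw [Pi.add_apply, Pi.single_eq_of_ne hi, add_zero]
      exact h2 i

/-- Gaussian elimination with pivoting over a valued field: `A` and its transpose have the same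
optimal lifting constant (at least `1`), and it is witnessed by a pair of vectors. -/
theorem exists_common_boundedLift [Fintype J] [DecidableEq J] (v : Valuation F ℝ≥0)
    {α : I → ℝ≥0} {β : J → ℝ≥0}
    (hα : ∀ i, 0 < α i) (hβ : ∀ j, 0 < β j) (A : Matrix J I F) :
    ∃ B : ℝ≥0, 1 ≤ B ∧ BoundedLift v A α β B ∧ BoundedLift v Aᵀ β⁻¹ α⁻¹ B ∧
      (B = 1 ∨ ∃ (x : I → F) (w : J → F) (C D : ℝ≥0), w ⬝ᵥ A *ᵥ x = 1 ∧
        (∀ j, β j * v ((A *ᵥ x) j) ≤ C) ∧ (∀ i, (α i)⁻¹ * v ((Aᵀ *ᵥ w) i) ≤ D) ∧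
        B * (C * D) ≤ 1) := by
  classical
  -- Induction on the number of nonzero rows: clearing kills row `j₀` and keeps zero rows zero.
  induction hn : (Finset.univ.filter fun j => A j ≠ 0).card using Nat.strong_induction_on
    generalizing A with
  | _ n ih =>
  by_cases hA : A = 0
  · subst hA
    refine ⟨1, le_rfl, boundedLift_zero v α β 1, ?_, Or.inl rfl⟩
    rw [transpose_zero]
    exact boundedLift_zero v _ _ 1
  obtain ⟨i₀, j₀, h₀, hpiv⟩ := exists_pivot v hA hα hβ
  have hv : 0 < v (A j₀ i₀) := pos_iff_ne_zero.2 ((Valuation.ne_zero_iff v).2 h₀)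
  have hlt : (Finset.univ.filter fun j => clearPivot A i₀ j₀ j ≠ 0).card < n := by
    rw [← hn]
    refine Finset.card_lt_card ((Finset.ssubset_iff_of_subset fun j hj => ?_).2 ⟨j₀, ?_, ?_⟩)
    · rw [Finset.mem_filter] at hj ⊢
      refine ⟨hj.1, fun h => hj.2 (funext fun i => ?_)⟩
      simp [clearPivot, h]
    · rw [Finset.mem_filter]
      exact ⟨Finset.mem_univ _, fun h => h₀ (congrFun h i₀)⟩
    · rw [Finset.mem_filter, not_and_not_right]
      refine fun _ => funext fun i => ?_
      simp [clearPivot, h₀]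
  obtain ⟨B', hB', hl, hr, hw⟩ := ih _ hlt _ rfl
  -- The inverse relative size of the pivot, that is, the cost of lifting along it.
  set s := α i₀ / (β j₀ * v (A j₀ i₀)) with hs
  have hb0 : 0 < β j₀ * v (A j₀ i₀) := mul_pos (hβ j₀) hv
  have hsB : α i₀ = s * (β j₀ * v (A j₀ i₀)) := (div_mul_cancel₀ _ hb0.ne').symm
  -- With inverted weights the same entry is a maximal pivot of the transpose.
  have hpivT : ∀ i j, α⁻¹ i * v (Aᵀ i j) * β⁻¹ j₀ ≤ α⁻¹ i₀ * v (Aᵀ i₀ j₀) * β⁻¹ j := by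
    intro i j
    have h1 := hpiv j i
    simp only [Pi.inv_apply, transpose_apply]
    rw [inv_mul_eq_div, inv_mul_eq_div, ← div_eq_mul_inv, ← div_eq_mul_inv, div_div, div_div,
      div_le_div_iff₀ (mul_pos (hα _) (hβ _)) (mul_pos (hα _) (hβ _))]
    linarith
  refine ⟨max B' s, hB'.trans (le_max_left _ _), ?_, ?_, ?_⟩
  · refine BoundedLift.of_clearPivot hα hβ h₀ hpiv ?_ (hl.mono (le_max_left _ _))
    exact hsB.trans_le (mul_le_mul_left (le_max_right _ _) _)
  · refine BoundedLift.of_clearPivot (i₀ := j₀) (j₀ := i₀) (fun j => inv_pos.2 (hβ j))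
      (fun i => inv_pos.2 (hα i)) h₀ hpivT ?_ ?_
    · have h1 : s ≤ max B' s := le_max_right _ _
      have h2 : β⁻¹ j₀ = s * (α⁻¹ i₀ * v (Aᵀ i₀ j₀)) := by
        have := (hα i₀).ne'
        have := (hβ j₀).ne'
        have := hv.ne'
        simp only [Pi.inv_apply, transpose_apply, hs]
        field_simp
      rw [h2]
      gcongr
    · rw [clearPivot_transpose]
      exact hr.mono (le_max_left _ _)
  · rcases le_total s B' with h | h
    · rw [max_eq_left h]
      refine hw.imp id ?_
      rintro ⟨x, w, C, D, h1, hC, hD, hCD⟩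
      -- Both old witnesses are corrected so that `A` and `Aᵀ` act on them as the cleared matrices
      -- do. The correction of `w` does not affect the pairing, since the cleared image vanishes at
      -- `j₀`.
      refine ⟨x + Pi.single i₀ (-((A j₀ i₀)⁻¹ * (A *ᵥ x) j₀)),
        w + Pi.single j₀ (-((Aᵀ i₀ j₀)⁻¹ * (Aᵀ *ᵥ w) i₀)), C, D, ?_, fun j => ?_, fun i => ?_, hCD⟩
      · rw [mulVec_sub_single_eq_clearPivot, add_dotProduct, single_dotProduct,
          clearPivot_mulVec_pivot A h₀, mul_zero, add_zero, h1]
      · rw [mulVec_sub_single_eq_clearPivot]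
        exact hC j
      · rw [mulVec_sub_single_eq_clearPivot, clearPivot_transpose]
        exact hD i
    · rw [max_eq_right h]
      -- The current pivot is the worst one, so basis vectors at the pivot are witnesses, with `C *
      -- D = 1 / s`.
      refine Or.inr ⟨Pi.single i₀ 1, Pi.single j₀ (A j₀ i₀)⁻¹, β j₀ * v (A j₀ i₀),
        (α i₀)⁻¹, ?_, fun j => ?_, fun i => ?_, ?_⟩
      · simp [h₀]
      · simp only [mulVec_single_one, col_apply]
        exact le_of_mul_le_mul_right (hpiv j i₀) (hα i₀)
      · have h1 := hpivT i j₀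
        simp only [Pi.inv_apply, transpose_apply] at h1
        have h2 : (α i)⁻¹ * v (A j₀ i) ≤ (α i₀)⁻¹ * v (A j₀ i₀) :=
          le_of_mul_le_mul_right h1 (inv_pos.2 (hβ j₀))
        simp only [mulVec_single, Pi.smul_apply, col_apply, transpose_apply,
          MulOpposite.smul_eq_mul_unop, MulOpposite.unop_op, map_mul, map_inv₀]
        rw [← mul_assoc, ← div_eq_mul_inv]
        exact (div_le_iff₀ hv).2 h2
      · rw [← mul_assoc, ← hsB, mul_inv_cancel₀ (hα i₀).ne']

end ValuedElimination

/-! ### The Novikov field and its valuation. -/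

section NovikovField

variable {G : AddSubgroup ℝ} {K : Type*} [Field K]

theorem coeff_mul_eq_finsum (x y : HahnSeries G K) (a : G) :
    (x * y).coeff a = ∑ᶠ g, x.coeff g * y.coeff (a - g) := by
  classical
  rw [HahnSeries.coeff_mul, finsum_eq_sum_of_support_subset
    (s := (Finset.antidiagonal x.isPWO_support y.isPWO_support a).image Prod.fst)]
  · rw [Finset.sum_image]
    · refine Finset.sum_congr rfl fun z hz => ?_
      rw [← (Finset.mem_antidiagonal.1 hz).2.2, add_sub_cancel_left]
    · intro z hz w hw h
      have h1 := (Finset.mem_antidiagonal.1 hz).2.2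
      have h2 := (Finset.mem_antidiagonal.1 hw).2.2
      refine Prod.ext h ?_
      rw [← h2, h] at h1
      exact add_left_cancel h1
  · intro g hg
    rw [Finset.coe_image]
    exact ⟨(g, a - g), Finset.mem_coe.2 (Finset.mem_antidiagonal.2
      ⟨left_ne_zero_of_mul hg, right_ne_zero_of_mul hg, add_sub_cancel _ _⟩), rfl⟩

theorem order_le_coe {x : HahnSeries G K} {g : G} (h : x.coeff g ≠ 0) :
    (x.order : ℝ) ≤ g :=
  HahnSeries.order_le_of_coeff_ne_zero h

/-- Comparing coefficients in `f * f⁻¹ = 1` shows that every exponent of `f⁻¹` other than `-o` comes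
from a smaller exponent of `f⁻¹` and a non-leading exponent of `f`. The latter stay a fixed `ε`
above `o`, so finiteness propagates upwards in steps of `ε`. -/
theorem finite_support_inv_lt {f : HahnSeries G K} (hf : f ≠ 0)
    (hfin : ∀ C : ℝ, {g : G | f.coeff g ≠ 0 ∧ (g : ℝ) < C}.Finite) (C : ℝ) :
    {g : G | f⁻¹.coeff g ≠ 0 ∧ (g : ℝ) < C}.Finite := by
  set h := f⁻¹ with hh
  set o := f.order with ho
  have hstep : ∀ g, h.coeff g ≠ 0 → g ≠ -o →
      ∃ a b : G, f.coeff a ≠ 0 ∧ o < a ∧ h.coeff b ≠ 0 ∧ (g : ℝ) = a + b - o := by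
    intro g hg hgo
    by_contra! hno
    have h1 : (f * h).coeff (o + g) = 0 := by
      rw [mul_inv_cancel₀ hf, HahnSeries.coeff_one, if_neg]
      intro h0
      exact hgo (eq_neg_of_add_eq_zero_right h0)
    rw [coeff_mul_eq_finsum, finsum_eq_single _ o, add_sub_cancel_left] at h1
    · exact mul_ne_zero (HahnSeries.coeff_order_eq_zero.not.2 hf) hg h1
    · intro a ha
      by_contra hne
      have ha0 := left_ne_zero_of_mul hne
      refine hno a (o + g - a) ha0
        (lt_of_le_of_ne (HahnSeries.order_le_of_coeff_ne_zero ha0) ha.symm)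
        (right_ne_zero_of_mul hne) ?_
      push_cast
      ring
  -- Finiteness below each level gives a least exponent above `o`; if `f` has only its leading term,
  -- any `ε` serves.
  obtain ⟨ε, hε, hgap⟩ : ∃ ε : ℝ, 0 < ε ∧ ∀ a, f.coeff a ≠ 0 → o < a → (o : ℝ) + ε ≤ a := by
    by_cases hne : {a : G | f.coeff a ≠ 0 ∧ o < a}.Nonempty
    · obtain ⟨a₀, ha₀, hoa⟩ := hne
      have hF : {a : G | (f.coeff a ≠ 0 ∧ o < a) ∧ a ≤ a₀}.Finite :=
        (hfin (a₀ + 1)).subset fun a ha => ⟨ha.1.1, by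
          have : (a : ℝ) ≤ a₀ := ha.2
          linarith⟩
      obtain ⟨a₁, ha₁, hmin⟩ := hF.exists_minimalFor id _ ⟨a₀, ⟨ha₀, hoa⟩, le_rfl⟩
      have h1 : (o : ℝ) < a₁ := ha₁.1.2
      refine ⟨a₁ - o, sub_pos.2 h1, fun a ha hoa' => ?_⟩
      rw [add_sub_cancel]
      by_contra! hlt
      have hlt' : a < a₁ := hlt
      exact absurd (hmin (j := a) ⟨⟨ha, hoa'⟩, hlt'.le.trans ha₁.2⟩ hlt'.le) (not_le.2 hlt')
    · refine ⟨1, one_pos, fun a ha hoa => absurd ⟨a, ha, hoa⟩ hne⟩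
  have key : ∀ n : ℕ, {g : G | h.coeff g ≠ 0 ∧ (g : ℝ) < h.order + n * ε}.Finite := by
    intro n
    induction n with
    | zero =>
      refine Set.finite_empty.subset fun g hg => ?_
      have h1 := order_le_coe hg.1
      have h2 := hg.2
      simp only [Nat.cast_zero, zero_mul, add_zero] at h2
      exact absurd h1 (not_le.2 h2)
    | succ n ih =>
      refine (((hfin (o + (n + 1) * ε)).image2 (fun a b => a + b - o) ih).insert (-o)).subset ?_
      rintro g ⟨hg, hlt⟩
      by_cases hgo : g = -o
      · exact Set.mem_insert_iff.2 (Or.inl hgo)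
      obtain ⟨a, b, ha, hoa, hb, hab⟩ := hstep g hg hgo
      have h1 := hgap a ha hoa
      have h2 := order_le_coe hb
      push_cast at hlt
      refine Or.inr ⟨a, ⟨ha, by linarith⟩, b, ⟨hb, by linarith⟩, ?_⟩
      apply Subtype.ext
      push_cast
      exact hab.symm
  obtain ⟨n, hn⟩ := exists_nat_gt ((C - h.order) / ε)
  refine (key n).subset fun g hg => ⟨hg.1, hg.2.trans ?_⟩
  rw [div_lt_iff₀ hε] at hn
  linarith

/-- The Novikov field of `G ⊆ ℝ`: the Hahn series over `G` which have only finitely many terms below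
each real number. -/
noncomputable def novikovField (G : AddSubgroup ℝ) (K : Type*) [Field K] :
    Subfield (HahnSeries G K) where
  carrier := {x | ∀ C : ℝ, {g : G | x.coeff g ≠ 0 ∧ (g : ℝ) < C}.Finite}
  zero_mem' := by simp
  one_mem' C := (Set.finite_singleton 0).subset fun g hg => by
    by_contra hne
    exact hg.1 (by rw [HahnSeries.coeff_one]; exact if_neg hne)
  add_mem' := fun {x y} hx hy C => ((hx C).union (hy C)).subset fun g hg => by
    by_cases h : x.coeff g = 0
    · exact Or.inr ⟨fun h' => hg.1 (by rw [HahnSeries.coeff_add, h, h', add_zero]), hg.2⟩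
    · exact Or.inl ⟨h, hg.2⟩
  neg_mem' := fun {x} hx C => (hx C).subset fun g hg =>
    ⟨fun h => hg.1 (by rw [HahnSeries.coeff_neg, h, neg_zero]), hg.2⟩
  mul_mem' := fun {x y} hx hy C => by
    refine ((hx (C - y.order)).image2 (· + ·) (hy (C - x.order))).subset ?_
    rintro a ⟨ha, hC⟩
    rw [coeff_mul_eq_finsum] at ha
    obtain ⟨g, hg⟩ := exists_ne_zero_of_finsum ha
    have h1 := order_le_coe (left_ne_zero_of_mul hg)
    have h2 := order_le_coe (right_ne_zero_of_mul hg)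
    push_cast at h2
    refine ⟨g, ⟨left_ne_zero_of_mul hg, by linarith⟩, a - g, ⟨right_ne_zero_of_mul hg, ?_⟩, ?_⟩
    · push_cast
      linarith
    · exact add_sub_cancel _ _
  inv_mem' x hx := by
    by_cases h : x = 0
    · rw [h, _root_.inv_zero]
      simp
    · exact finite_support_inv_lt h hx

/-- The real exponential as a map to the nonnegative reals. -/
noncomputable def expNN (r : ℝ) : ℝ≥0 := ⟨Real.exp r, (Real.exp_pos r).le⟩

theorem expNN_pos (r : ℝ) : 0 < expNN r := Real.exp_pos r

theorem expNN_add (r s : ℝ) : expNN (r + s) = expNN r * expNN s :=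
  Subtype.ext (Real.exp_add r s)

theorem expNN_zero : expNN 0 = 1 := Subtype.ext Real.exp_zero

theorem expNN_neg (r : ℝ) : expNN (-r) = (expNN r)⁻¹ := Subtype.ext (Real.exp_neg r)

theorem expNN_le_expNN {r s : ℝ} : expNN r ≤ expNN s ↔ r ≤ s := Real.exp_le_exp

theorem exists_expNN_eq {t : ℝ≥0} (ht : 0 < t) : ∃ r, expNN r = t :=
  ⟨Real.log t, Subtype.ext (Real.exp_log (NNReal.coe_pos.2 ht))⟩

open Classical in
/-- The valuation `x ↦ exp (- order x)`. -/
noncomputable def expValuation (G : AddSubgroup ℝ) (K : Type*) [Field K] :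
    Valuation (HahnSeries G K) ℝ≥0 where
  toFun x := if x = 0 then 0 else expNN (-(x.order : ℝ))
  map_zero' := if_pos rfl
  map_one' := by
    rw [if_neg one_ne_zero, HahnSeries.order_one]
    simp [expNN_zero]
  map_mul' x y := by
    by_cases hx : x = 0
    · simp [hx]
    by_cases hy : y = 0
    · simp [hy]
    rw [if_neg hx, if_neg hy, if_neg (mul_ne_zero hx hy), ← expNN_add,
      HahnSeries.order_mul hx hy]
    congr 1
    push_cast
    ring
  map_add_le_max' x y := by
    by_cases hx : x = 0
    · simp [hx]
    by_cases hy : y = 0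
    · simp [hy]
    by_cases hxy : x + y = 0
    · simp [hxy]
    rw [if_neg hx, if_neg hy, if_neg hxy, le_max_iff, expNN_le_expNN, expNN_le_expNN,
      neg_le_neg_iff, neg_le_neg_iff]
    exact min_le_iff.1 (HahnSeries.min_order_le_order_add hxy)

theorem expValuation_le_iff {x : HahnSeries G K} {r : ℝ} :
    expValuation G K x ≤ expNN r ↔ ∀ g : G, x.coeff g ≠ 0 → -(g : ℝ) ≤ r := by
  classical
  change (if x = 0 then 0 else expNN (-(x.order : ℝ))) ≤ _ ↔ _
  by_cases hx : x = 0
  · simp [hx]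
  rw [if_neg hx, expNN_le_expNN]
  constructor
  · intro h g hg
    have := order_le_coe hg
    linarith
  · exact fun h => h _ (HahnSeries.coeff_order_eq_zero.not.2 hx)

/-- A sequence that never returns to `f 0` or above stays in a finite set, where a monotone pair
must occur. -/
theorem isPWO_of_finite_lt {s : Set G} (hs : ∀ C : ℝ, {g : G | g ∈ s ∧ (g : ℝ) < C}.Finite) :
    s.IsPWO := by
  intro f
  by_cases h : ∃ n, 0 < n ∧ f 0 ≤ f n
  · obtain ⟨n, hn, hle⟩ := h
    exact ⟨0, n, hn, hle⟩
  · push Not at h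
    -- The `+ 1` makes the strict bound hold for `n = 0` too.
    have hlt : ∀ n, ((f n : G) : ℝ) < (f 0 : G) + 1 := fun n => ?_
    · obtain ⟨m, n, hmn, hle⟩ := (hs ((f 0 : G) + 1)).isPWO fun n => ⟨f n, (f n).2, hlt n⟩
      exact ⟨m, n, hmn, hle⟩
    rcases Nat.eq_zero_or_pos n with rfl | hn
    · linarith
    · have : ((f n : G) : ℝ) < (f 0 : G) := h n hn
      linarith

end NovikovField

/-! ### Novikov coordinates on the chains of one degree. -/

/-- A parametrization of the elements of degree `k` by `I × G`, in which translation of the second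
coordinate corresponds to the group action. -/
structure Chart {Γ P S : Type*} [CommGroup Γ] (B : Base Γ P S) (G : AddSubgroup ℝ) (lift : G → Γ)
    (k : ℤ) (I : Type*) where
  pt : I → G → P
  height : I → ℝ
  A_pt : ∀ i g, B.A (pt i g) = height i - g
  act_pt : ∀ h i g, B.act (lift h) (pt i g) = pt i (g + h)
  pt_injective : Function.Injective fun z : I × G => pt z.1 z.2
  gr_pt : ∀ i g, B.gr (pt i g) = k
  exists_pt : ∀ p, B.gr p = k → ∃ i g, pt i g = p

namespace Chart

variable {K Γ P S I J : Type*} [Field K] [CommGroup Γ] {B : Base Γ P S} {G : AddSubgroup ℝ}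
  {lift : G → Γ} {k : ℤ}

theorem range_pt (φ : Chart B G lift k I) :
    (Set.range fun z : I × G => φ.pt z.1 z.2) = {p | B.gr p = k} := by
  ext p
  constructor
  · rintro ⟨z, rfl⟩
    exact φ.gr_pt _ _
  · intro hp
    obtain ⟨i, g, h⟩ := φ.exists_pt p hp
    exact ⟨(i, g), h⟩

theorem finsum_eq [Fintype I] (φ : Chart B G lift k I) {f : P → K}
    (hf : ∀ p, f p ≠ 0 → B.gr p = k) (hfin : (Function.support f).Finite) :
    ∑ᶠ p, f p = ∑ i, ∑ᶠ g, f (φ.pt i g) := by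
  have h1 : ∑ᶠ p, f p = ∑ᶠ z : I × G, f (φ.pt z.1 z.2) := by
    rw [← finsum_mem_univ, ← finsum_mem_range φ.pt_injective, range_pt]
    refine finsum_mem_inter_support_eq f _ _ ?_
    ext p
    simp only [Set.univ_inter, Set.mem_inter_iff, Set.mem_ofPred_eq, Function.mem_support]
    exact ⟨fun h => ⟨hf p h, h⟩, fun h => h.2⟩
  rw [h1, finsum_curry _ (hfin.preimage φ.pt_injective.injOn), finsum_eq_sum_of_fintype]

/-- The function on `P` with the given Novikov coordinates. -/
noncomputable def chainFun (φ : Chart B G lift k I) (x : I → novikovField G K) : P → K :=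
  Function.extend (fun z : I × G => φ.pt z.1 z.2) (fun z => (x z.1).1.coeff z.2) 0

theorem chainFun_pt (φ : Chart B G lift k I) (x : I → novikovField G K) (i : I) (g : G) :
    φ.chainFun x (φ.pt i g) = (x i).1.coeff g :=
  φ.pt_injective.extend_apply _ _ (i, g)

theorem gr_eq_of_chainFun (φ : Chart B G lift k I) {x : I → novikovField G K} {p : P}
    (hp : φ.chainFun x p ≠ 0) : B.gr p = k := by
  by_contra h
  refine hp (Function.extend_apply' _ _ _ ?_)
  rintro ⟨z, rfl⟩
  exact h (φ.gr_pt _ _)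

/-- The chain with the given Novikov coordinates. -/
noncomputable def chain [Finite I] (φ : Chart B G lift k I) (x : I → novikovField G K) :
    B.chains K := ⟨φ.chainFun x, by
  refine ⟨fun C => ?_, (Set.finite_singleton k).subset ?_⟩
  · refine (Set.finite_iUnion fun i =>
      ((x i).2 (φ.height i - C)).image fun g => φ.pt i g).subset ?_
    rintro p ⟨hp, hC⟩
    obtain ⟨i, g, rfl⟩ := φ.exists_pt p (φ.gr_eq_of_chainFun hp)
    rw [chainFun_pt] at hp
    rw [φ.A_pt] at hC
    exact Set.mem_iUnion.2 ⟨i, g, ⟨hp, by linarith⟩, rfl⟩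
  · rintro _ ⟨p, hp, rfl⟩
    exact φ.gr_eq_of_chainFun hp⟩

theorem chain_pt [Finite I] (φ : Chart B G lift k I) (x : I → novikovField G K) (i : I) (g : G) :
    (φ.chain x).1 (φ.pt i g) = (x i).1.coeff g :=
  φ.chainFun_pt x i g

theorem chain_mem [Finite I] (φ : Chart B G lift k I) (x : I → novikovField G K) :
    φ.chain x ∈ B.chainsDeg K k := fun _ hp => φ.gr_eq_of_chainFun hp

/-- The Novikov coordinates of a chain. -/
noncomputable def coord (φ : Chart B G lift k I) (a : B.chains K) (i : I) : novikovField G K :=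
  have h : ∀ C : ℝ, {g : G | a.1 (φ.pt i g) ≠ 0 ∧ (g : ℝ) < C}.Finite := fun C => by
    refine Set.Finite.of_finite_image ((a.2.1 (φ.height i - C)).subset ?_)
      (f := fun g => φ.pt i g) fun g _ g' _ h => (Prod.ext_iff.1 (φ.pt_injective (a₁ := (i, g))
        (a₂ := (i, g')) h)).2
    rintro _ ⟨g, ⟨hg, hC⟩, rfl⟩
    refine ⟨hg, ?_⟩
    rw [φ.A_pt]
    linarith
  ⟨⟨fun g => a.1 (φ.pt i g), isPWO_of_finite_lt h⟩, h⟩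

theorem coord_coeff (φ : Chart B G lift k I) (a : B.chains K) (i : I) (g : G) :
    (φ.coord a i).1.coeff g = a.1 (φ.pt i g) := rfl

theorem chain_coord [Finite I] (φ : Chart B G lift k I) {a : B.chains K}
    (ha : a ∈ B.chainsDeg K k) : φ.chain (φ.coord a) = a := by
  refine Subtype.ext (funext fun p => ?_)
  by_cases hp : B.gr p = k
  · obtain ⟨i, g, rfl⟩ := φ.exists_pt p hp
    rw [chain_pt, coord_coeff]
  · have h1 : a.1 p = 0 := by
      by_contra h
      exact hp (ha p h)
    have h2 : (φ.chain (φ.coord a)).1 p = 0 := by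
      by_contra h
      exact hp (φ.chain_mem _ p h)
    rw [h1, h2]

/-- The term at exponent `g` has action `height i - g`, so the level is the logarithm of a weighted
maximum norm. Comparison with a real bound covers the zero chain as well. -/
theorem level_chain_le_iff [Finite I] (φ : Chart B G lift k I) (x : I → novikovField G K) (r : ℝ) :
    B.level (φ.chain x) ≤ r ↔
      ∀ i, expNN (φ.height i) * (expValuation G K).comap (novikovField G K).subtype (x i) ≤
        expNN r := by
  have h1 : ∀ i, expNN (φ.height i) * (expValuation G K).comap (novikovField G K).subtype (x i) ≤
      expNN r ↔ ∀ g : G, (x i).1.coeff g ≠ 0 → φ.height i - g ≤ r := by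
    intro i
    rw [← le_div_iff₀' (expNN_pos _), div_eq_mul_inv, ← expNN_neg, ← expNN_add]
    refine expValuation_le_iff.trans (forall₂_congr fun g _ => ?_)
    constructor <;> intro <;> linarith
  simp only [h1]
  constructor
  · intro h i g hg
    rw [← φ.A_pt, ← EReal.coe_le_coe_iff]
    refine (B.le_level _ ?_).trans h
    rwa [chain_pt]
  · intro h
    refine B.level_le _ fun p hp => ?_
    obtain ⟨i, g, rfl⟩ := φ.exists_pt p (φ.chain_mem _ p hp)
    rw [chain_pt] at hp
    rw [EReal.coe_le_coe_iff, φ.A_pt]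
    exact h i g hp

/-- The induced chart of the opposite data. -/
def op (φ : Chart B G lift k I) : Chart B.op G lift (-k) I where
  -- The opposite action is by inverses and the action functional changes sign, so the
  -- `G`-coordinate must be reflected.
  pt i g := φ.pt i (-g)
  height i := -φ.height i
  A_pt i g := by
    change -B.A (φ.pt i (-g)) = _
    rw [φ.A_pt]
    push_cast
    ring
  act_pt h i g := by
    change B.act (lift h)⁻¹ (φ.pt i (-g)) = _
    have h1 := φ.act_pt h i (-(g + h))
    rw [neg_add, neg_add_cancel_right, ← neg_add] at h1
    rw [← h1, B.act_inv_act]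
  pt_injective z w h := by
    have h1 := Prod.ext_iff.1 (φ.pt_injective (a₁ := (z.1, -z.2)) (a₂ := (w.1, -w.2)) h)
    exact Prod.ext h1.1 (neg_injective h1.2)
  gr_pt i g := congrArg Neg.neg (φ.gr_pt i (-g))
  exists_pt p hp := by
    obtain ⟨i, g, h⟩ := φ.exists_pt p (neg_injective hp)
    exact ⟨i, -g, by rw [neg_neg, h]⟩

/-- The coefficient at `0` of a product pairs exponents `g` and `-g`, and the reflection in the
opposite chart makes these the same point of `P`. -/
theorem pairing_chain [Fintype I] (φ : Chart B G lift k I) (w x : I → novikovField G K) :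
    B.pairing (φ.op.chain w) (φ.chain x) = (w ⬝ᵥ x).1.coeff 0 := by
  unfold Base.pairing
  rw [φ.finsum_eq (fun p hp => φ.chain_mem x p (right_ne_zero_of_mul hp))
    (B.pairing_finite (φ.op.chain w).2 (φ.chain x).2)]
  have h1 : (w ⬝ᵥ x).1 = ∑ i, (w i).1 * (x i).1 := by
    simp [dotProduct]
  rw [h1, HahnSeries.coeff_sum]
  refine Finset.sum_congr rfl fun i _ => ?_
  rw [mul_comm, coeff_mul_eq_finsum]
  refine finsum_congr fun g => ?_
  have h2 : φ.pt i g = φ.op.pt i (0 - g) := by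
    change _ = φ.pt i (-(0 - g))
    rw [zero_sub, neg_neg]
  rw [chain_pt, h2, chain_pt, mul_comm]

end Chart

/-! ### The boundary operator as a matrix over the Novikov field. -/

namespace FloerNovikovComplex

variable {K Γ P S I J : Type*} [Field K] [CommGroup Γ] [Group.FG Γ] [Finite S]
  {G : AddSubgroup ℝ} {lift : G → Γ} {k m : ℤ}

/-- The matrix of the boundary operator over the Novikov field. -/
noncomputable def bdMatrix (c : FloerNovikovComplex K Γ P S) (φ : Chart c.toBase G lift k I)
    (ψ : Chart c.toBase G lift m J) : Matrix J I (novikovField G K) :=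
  Matrix.of fun j i => ψ.coord (c.bd (c.gen K (φ.pt i 0))) j

/-- By equivariance `n` depends only on the difference `h - g`, so the boundaries of the base points
`φ.pt i 0` determine everything. -/
theorem bdMatrix_coeff (c : FloerNovikovComplex K Γ P S) (φ : Chart c.toBase G lift k I)
    (ψ : Chart c.toBase G lift m J) (i : I) (j : J) (g h : G) :
    (c.bdMatrix φ ψ j i).1.coeff (h - g) = c.n (φ.pt i g) (ψ.pt j h) := by
  have h1 := c.n_act (lift g) (φ.pt i 0) (ψ.pt j (h - g))
  rw [φ.act_pt, ψ.act_pt, zero_add, sub_add_cancel] at h1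
  exact h1.symm

/-- Since `n` depends on differences only, the coefficient formula `bd_apply` is a convolution,
which is multiplication of Hahn series. -/
theorem bd_chain [Fintype I] [Finite J] (c : FloerNovikovComplex K Γ P S)
    (φ : Chart c.toBase G lift k I) (ψ : Chart c.toBase G lift m J) (hk : k = m + 1)
    (x : I → novikovField G K) : c.bd (φ.chain x) = ψ.chain (c.bdMatrix φ ψ *ᵥ x) := by
  have hm : c.bd (φ.chain x) ∈ c.chainsDeg K m := by
    have := c.bd_mem k _ (φ.chain_mem x)
    rwa [show k - 1 = m by omega] at this
  rw [← ψ.chain_coord hm]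
  congr 1
  refine funext fun j => Subtype.ext (HahnSeries.ext (funext fun h => ?_))
  have h1 : ((c.bdMatrix φ ψ *ᵥ x) j).1 = ∑ i, (c.bdMatrix φ ψ j i).1 * (x i).1 := by
    simp [mulVec, dotProduct]
  rw [Chart.coord_coeff, bd_apply, h1, HahnSeries.coeff_sum,
    φ.finsum_eq (fun p hp => φ.chain_mem x p (left_ne_zero_of_mul hp))
      (((φ.chain x).2.1 (c.A (ψ.pt j h))).subset fun p hp =>
        ⟨left_ne_zero_of_mul hp, c.A_lt_of_n (right_ne_zero_of_mul hp)⟩)]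
  refine Finset.sum_congr rfl fun i _ => ?_
  rw [mul_comm, coeff_mul_eq_finsum]
  exact finsum_congr fun g => by rw [bdMatrix_coeff, Chart.chain_pt]

theorem opposite_n (c : FloerNovikovComplex K Γ P S) (p q : P) :
    c.opposite.n p q = c.n q p := by
  classical
  change ∑ᶠ r, (indicatorOne p : P → K) r * c.n q r = _
  rw [finsum_eq_single _ p fun r hr => by simp [indicatorOne, hr]]
  simp [indicatorOne]

theorem bdMatrix_opposite (c : FloerNovikovComplex K Γ P S) (φ : Chart c.toBase G lift k I)
    (ψ : Chart c.toBase G lift m J) :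
    c.opposite.bdMatrix (Chart.op ψ) (Chart.op φ) = (c.bdMatrix φ ψ)ᵀ := by
  refine Matrix.ext fun i j => Subtype.ext (HahnSeries.ext (funext fun g => ?_))
  rw [transpose_apply]
  have h1 := c.opposite.bdMatrix_coeff (Chart.op ψ) (Chart.op φ) j i 0 g
  have h2 := c.bdMatrix_coeff φ ψ i j (-g) 0
  rw [sub_zero] at h1
  rw [zero_sub, neg_neg] at h2
  rw [h1, h2, opposite_n]
  change c.n (φ.pt i (-g)) (ψ.pt j (-0)) = _
  rw [neg_zero]

end FloerNovikovComplex

/-! ### Existence of charts, and auxiliary inequalities. -/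

/-- If `ω` is injective on the kernel of `deg`, then every degree has a chart. -/
theorem exists_chart.{u, v, w} {Γ : Type u} {P : Type v} {S : Type w} [CommGroup Γ] [Finite S]
    (B : Base Γ P S) (hinj : Set.InjOn B.ω (B.deg.ker : Set Γ)) :
    ∃ (G : AddSubgroup ℝ) (lift : G → Γ), ∀ k : ℤ, ∃ (I : Type w) (_ : Fintype I),
      Nonempty (Chart B G lift k I) := by
  classical
  -- By injectivity `ω` is an isomorphism from `ker deg` onto `G`, and `lift` is its inverse.
  let G : AddSubgroup ℝ := Subgroup.toAddSubgroup' (B.deg.ker.map B.ω)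
  have hG : ∀ r : G, ∃ g : Γ, B.deg g = 1 ∧ (B.ω g).toAdd = r := by
    rintro ⟨r, g, hg, hr⟩
    exact ⟨g, hg, congrArg Multiplicative.toAdd hr⟩
  choose lift hdeg hω using hG
  have hlift : ∀ g : Γ, B.deg g = 1 → ∃ r : G, lift r = g := fun g hg =>
    ⟨⟨(B.ω g).toAdd, g, hg, rfl⟩, hinj (hdeg _) hg (Multiplicative.toAdd.injective (hω _))⟩
  have hadd : ∀ r s : G, lift (s + r) = lift r * lift s := fun r s => by
    refine hinj (hdeg _) (mul_mem (hdeg r) (hdeg s)) (Multiplicative.toAdd.injective ?_)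
    rw [hω, map_mul, toAdd_mul, hω, hω, add_comm]
    rfl
  refine ⟨G, lift, fun k => ?_⟩
  -- Points of degree `k` in one fibre differ by an element of `ker deg`, so one base point for each
  -- fibre meeting degree `k` suffices.
  let I := {s : S // ∃ p, B.proj p = s ∧ B.gr p = k}
  choose base hbase hgr using fun i : I => i.2
  refine ⟨I, Fintype.ofFinite I, ⟨⟨fun i g => B.act (lift g) (base i), fun i => B.A (base i),
    fun i g => ?_, fun h i g => ?_, ?_, fun i g => ?_, fun p hp => ?_⟩⟩⟩
  · rw [B.A_act, hω]
  · rw [hadd, map_mul, Equiv.Perm.mul_apply]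
  · rintro ⟨i, g⟩ ⟨j, h⟩ hh
    dsimp only at hh
    have h1 : ∀ g p, B.proj (B.act g p) = B.proj p := fun g p =>
      ((B.proj_eq_iff _ _).2 ⟨g, rfl⟩).symm
    have hij : i = j := by
      have h2 := congrArg B.proj hh
      rw [h1, h1, hbase, hbase] at h2
      exact Subtype.ext h2
    subst hij
    have h2 : (lift h)⁻¹ * lift g = 1 := B.act_free _ (base i) (by
      rw [map_mul, Equiv.Perm.mul_apply, hh, B.act_inv_act])
    have h3 : g = h := by
      apply Subtype.ext
      rw [← hω, ← hω, inv_mul_eq_one.1 h2]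
    rw [h3]
  · rw [B.gr_act, hdeg, hgr]
    simp
  · have hi := hbase ⟨B.proj p, p, rfl, hp⟩
    obtain ⟨g, hg⟩ := (B.proj_eq_iff _ _).1 hi
    have hg1 : B.deg g = 1 := by
      have h1 := B.gr_act g (base ⟨B.proj p, p, rfl, hp⟩)
      rw [hg, hgr] at h1
      exact Multiplicative.toAdd.injective (by rw [toAdd_one]; omega)
    obtain ⟨r, rfl⟩ := hlift g hg1
    exact ⟨_, r, hg⟩

/-- A generator occurring in both chains contributes `A p` to one level and `-A p` to the other. -/
theorem Base.nonneg_level_add_level {K Γ P S : Type*} [Field K] [CommGroup Γ] (B : Base Γ P S)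
    {d : B.op.chains K} {a : B.chains K} (h : B.pairing d a ≠ 0) :
    0 ≤ B.level a + B.op.level d := by
  obtain ⟨p, hp⟩ := exists_ne_zero_of_finsum h
  have h1 := add_le_add (B.le_level a (right_ne_zero_of_mul hp))
    (B.op.le_level d (left_ne_zero_of_mul hp))
  refine le_trans (le_of_eq ?_) h1
  change _ = (B.A p : EReal) + ((-B.A p : ℝ) : EReal)
  rw [← EReal.coe_add, add_neg_cancel, EReal.coe_zero]

/-- The filtration is strict, so the depth applies only at `γ` above the level `u`; this is the
passage to the limit `γ → u`. -/
theorem neg_le_add_of_forall_lt {u s b : ℝ}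
    (h : ∀ γ : ℝ, u < γ → ∃ t : EReal, t < ((γ + b : ℝ) : EReal) ∧ 0 ≤ t + s) :
    -(b : EReal) ≤ (u : EReal) + s := by
  rw [← EReal.coe_neg, ← EReal.coe_add, EReal.coe_le_coe_iff]
  by_contra! hlt
  -- If the claim fails this `γ` exceeds `u`, and it forces `t < -s`.
  obtain ⟨t, ht, h0⟩ := h (-b - s) (by linarith)
  induction t with
  | bot => simp at h0
  | top => exact absurd ht not_top_lt
  | coe t =>
    rw [EReal.coe_lt_coe_iff] at ht
    rw [← EReal.coe_add, ← EReal.coe_zero, EReal.coe_le_coe_iff] at h0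
    linarith

/-- A zero bound would force `z = 0`. Positivity allows the bounds of the witnesses to be written as
exponentials. -/
theorem pos_of_dotProduct_eq_one {F L : Type*} [Field F] [Fintype L] (v : Valuation F ℝ≥0)
    {u z : L → F} {f : L → ℝ≥0} {E : ℝ≥0} (huz : u ⬝ᵥ z = 1) (hf : ∀ l, 0 < f l)
    (hE : ∀ l, f l * v (z l) ≤ E) : 0 < E := by
  rw [pos_iff_ne_zero]
  rintro rfl
  refine one_ne_zero (huz.symm.trans (Finset.sum_eq_zero fun l _ => ?_))
  have h2 := nonpos_iff_eq_zero.1 (hE l)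
  rw [mul_eq_zero, or_iff_right (hf l).ne', Valuation.zero_iff] at h2
  rw [h2, mul_zero]

/-! ### Boundary depth, bounded lifts and the linking form. -/

namespace FloerNovikovComplex

variable {K Γ P S I J : Type*} [Field K] [CommGroup Γ] [Group.FG Γ] [Finite S]
  {G : AddSubgroup ℝ} {lift : G → Γ} {k m : ℤ}

theorem boundaryDepth_nonneg (c : FloerNovikovComplex K Γ P S) (m : ℤ) :
    0 ≤ c.boundaryDepth m := by
  refine le_sInf ?_
  rintro _ ⟨b, ⟨hb, -⟩, rfl⟩
  exact EReal.coe_nonneg.2 hb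

theorem boundaryDepth_le [Fintype I] [Finite J] (c : FloerNovikovComplex K Γ P S)
    (φ : Chart c.toBase G lift k I) (ψ : Chart c.toBase G lift m J) (hk : k = m + 1) {b : ℝ}
    (hb : 0 ≤ b)
    (h : BoundedLift ((expValuation G K).comap (novikovField G K).subtype) (c.bdMatrix φ ψ)
      (fun i => expNN (φ.height i)) (fun j => expNN (ψ.height j)) (expNN b)) :
    c.boundaryDepth m ≤ b := by
  refine sInf_le ⟨b, ⟨hb, ?_⟩, rfl⟩
  rintro γ _ ⟨⟨a, ha, rfl⟩, -, hγ⟩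
  -- A real number strictly between the level, possibly `⊥`, and `γ` turns the strict filtration
  -- condition into a norm bound.
  obtain ⟨r, hr, hrγ⟩ := EReal.lt_iff_exists_real_btwn.1 hγ
  have ha' : a ∈ c.chainsDeg K k := by rw [hk]; exact ha
  obtain ⟨x, hx, hbd⟩ := h (φ.coord a)
  have h1 : c.bd (φ.chain x) = c.bd a := by
    rw [c.bd_chain φ ψ hk, hx, ← c.bd_chain φ ψ hk, φ.chain_coord ha']
  refine ⟨φ.chain x, ⟨?_, ?_⟩, h1⟩
  · rw [← hk]
    exact φ.chain_mem x
  · have h2 : c.level (φ.chain x) ≤ ((b + r : ℝ) : EReal) := by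
      rw [φ.level_chain_le_iff, expNN_add]
      refine hbd _ ((ψ.level_chain_le_iff _ r).1 ?_)
      rw [← hx, ← c.bd_chain φ ψ hk, h1]
      exact hr.le
    refine h2.trans_lt ?_
    rw [EReal.coe_lt_coe_iff] at hrγ ⊢
    linarith

theorem ne_zero_of_linkingForm {c : FloerNovikovComplex K Γ P S}
    {x : c.opposite.boundaries (-k + 1)} {y : c.boundaries k} (h : c.linkingForm k x y ≠ 0) :
    y.1 ≠ 0 ∧ x.1 ≠ 0 := by
  constructor
  · intro h0
    refine h ?_
    rw [c.linkingForm_eq k x y 0 (by rw [h0, map_zero])]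
    simp [Base.pairing]
  · intro h0
    refine h ?_
    unfold linkingForm
    rw [h0]
    simp [Base.pairing]

/-- Any admissible `b` lifts `y` to some `a` of level below `γ + b`, for each `γ > ℓ(y)`. As `a`
pairs nontrivially with `x`, its level is at least `-ℓᵒᵖ(x)`. -/
theorem neg_boundaryDepth_le (c : FloerNovikovComplex K Γ P S) (hk : k = m + 1)
    (x : c.opposite.boundaries (-k + 1)) (y : c.boundaries k) (h : c.linkingForm k x y ≠ 0) :
    -c.boundaryDepth m ≤ c.level y.1 + c.opposite.level x.1 := by
  rw [EReal.neg_le]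
  refine le_sInf ?_
  rintro _ ⟨b, ⟨-, hb⟩, rfl⟩
  rw [EReal.neg_le]
  obtain ⟨hy, hx⟩ := ne_zero_of_linkingForm h
  obtain ⟨p, -, hp⟩ := c.exists_level_eq _ hy
  obtain ⟨q, -, hq⟩ := c.op.exists_level_eq _ hx
  change _ ≤ c.level y.1 + c.op.level x.1
  rw [hp, hq]
  refine neg_le_add_of_forall_lt fun γ hγ => ?_
  have hy' : y.1 ∈ c.boundaries (m + 1) := by rw [← hk]; exact y.2
  have hdeg : y.1 ∈ c.chainsDeg K m := by
    obtain ⟨a, ha, hay⟩ := hy'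
    have := c.bd_mem _ a ha
    rwa [hay, add_sub_cancel_right] at this
  obtain ⟨a, ⟨-, ha⟩, hay⟩ := hb γ ⟨hy', hdeg, by rw [hp]; exact EReal.coe_lt_coe_iff.2 hγ⟩
  refine ⟨_, ha, ?_⟩
  rw [← hq]
  refine c.nonneg_level_add_level ?_
  rwa [← c.linkingForm_eq k x y a hay]

/-- The same argument with the roles exchanged: `x` is lifted through `δ` to `d`, and adjunction
gives `Δ(d, y) = λ(x, y)`. -/
theorem neg_boundaryDepth_opposite_le (c : FloerNovikovComplex K Γ P S)
    (x : c.opposite.boundaries (-k + 1)) (y : c.boundaries k) (h : c.linkingForm k x y ≠ 0) :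
    -c.opposite.boundaryDepth (-k) ≤ c.level y.1 + c.opposite.level x.1 := by
  rw [EReal.neg_le]
  refine le_sInf ?_
  rintro _ ⟨b, ⟨-, hb⟩, rfl⟩
  rw [EReal.neg_le, add_comm]
  obtain ⟨hy, hx⟩ := ne_zero_of_linkingForm h
  obtain ⟨p, -, hp⟩ := c.exists_level_eq _ hy
  obtain ⟨q, -, hq⟩ := c.op.exists_level_eq _ hx
  change _ ≤ c.op.level x.1 + c.level y.1
  rw [hp, hq]
  refine neg_le_add_of_forall_lt fun γ hγ => ?_
  have hdeg : x.1 ∈ c.opposite.chainsDeg K (-k) := by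
    obtain ⟨d, hd, hdx⟩ := x.2
    have := c.opposite.bd_mem _ d hd
    rwa [hdx, add_sub_cancel_right] at this
  obtain ⟨d, ⟨-, hd⟩, hdx⟩ := hb γ ⟨x.2, hdeg, hq.trans_lt (EReal.coe_lt_coe_iff.2 hγ)⟩
  refine ⟨_, hd, ?_⟩
  rw [← hp, add_comm]
  refine c.nonneg_level_add_level ?_
  obtain ⟨a, -, hay⟩ := y.2
  rw [c.linkingForm_eq k x y a hay, ← hdx] at h
  rw [← hay]
  exact (c.pairing_opBd d a).symm.trans_ne h

/-- The pair is `δ` of the chain of `w` and `∂` of the chain of `x`. By adjunction its linking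
number is the coefficient at `0` of `w ⬝ᵥ A *ᵥ x = 1`, and `C`, `D` bound the two levels. -/
theorem exists_linkingForm_ne_zero [Fintype I] [Fintype J] (c : FloerNovikovComplex K Γ P S)
    (φ : Chart c.toBase G lift k I) (ψ : Chart c.toBase G lift m J) (hk : k = m + 1) {b : ℝ}
    {x : I → novikovField G K} {w : J → novikovField G K} {C D : ℝ≥0}
    (h1 : w ⬝ᵥ c.bdMatrix φ ψ *ᵥ x = 1)
    (hC : ∀ j, expNN (ψ.height j) * (expValuation G K).comap (novikovField G K).subtype
      ((c.bdMatrix φ ψ *ᵥ x) j) ≤ C)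
    (hD : ∀ i, (expNN (φ.height i))⁻¹ * (expValuation G K).comap (novikovField G K).subtype
      (((c.bdMatrix φ ψ)ᵀ *ᵥ w) i) ≤ D)
    (hCD : expNN b * (C * D) ≤ 1) :
    ∃ (x : c.opposite.boundaries (-k + 1)) (y : c.boundaries k),
      c.linkingForm k x y ≠ 0 ∧ c.level y.1 + c.opposite.level x.1 ≤ ((-b : ℝ) : EReal) := by
  have hC0 : 0 < C := pos_of_dotProduct_eq_one _ h1 (fun _ => expNN_pos _) hC
  have h1' : x ⬝ᵥ (c.bdMatrix φ ψ)ᵀ *ᵥ w = 1 := by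
    rw [mulVec_transpose, dotProduct_comm, ← dotProduct_mulVec, h1]
  have hD0 : 0 < D := pos_of_dotProduct_eq_one _ h1' (fun i => inv_pos.2 (expNN_pos _)) hD
  obtain ⟨γ, rfl⟩ := exists_expNN_eq hC0
  obtain ⟨ε, rfl⟩ := exists_expNN_eq hD0
  rw [← expNN_add, ← expNN_add, ← expNN_zero, expNN_le_expNN] at hCD
  have hbd := c.bd_chain φ ψ hk x
  have hopBd : c.opBd ((Chart.op ψ).chain w) = (Chart.op φ).chain ((c.bdMatrix φ ψ)ᵀ *ᵥ w) := by
    rw [← bdMatrix_opposite]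
    exact c.opposite.bd_chain (Chart.op ψ) (Chart.op φ) (by omega) w
  have hw : (Chart.op ψ).chain w ∈ c.opposite.chainsDeg K (-k + 1) := by
    rw [show -k + 1 = -m by omega]
    exact (Chart.op ψ).chain_mem w
  refine ⟨⟨c.opBd ((Chart.op ψ).chain w), _, hw, rfl⟩, ⟨c.bd (φ.chain x), _, φ.chain_mem x, rfl⟩,
    ?_, ?_⟩
  · rw [c.linkingForm_eq k _ _ (φ.chain x) rfl, c.pairing_opBd, hbd, ψ.pairing_chain, h1]
    change (1 : HahnSeries G K).coeff 0 ≠ 0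
    rw [HahnSeries.coeff_one, if_pos rfl]
    exact one_ne_zero
  · have h2 : c.level (c.bd (φ.chain x)) ≤ γ := by
      rw [hbd, ψ.level_chain_le_iff]
      exact hC
    have h3 : c.op.level (c.opBd ((Chart.op ψ).chain w)) ≤ ε := by
      rw [hopBd, (Chart.op φ).level_chain_le_iff]
      intro i
      rw [show (Chart.op φ).height i = -φ.height i from rfl, expNN_neg]
      exact hD i
    refine (add_le_add h2 h3).trans ?_
    rw [← EReal.coe_add, EReal.coe_le_coe_iff]
    linarith

end FloerNovikovComplex

end FloerNovikov

/-! ### Assembling the inequalities. -/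

theorem mainTheorem3 {K Γ P S : Type*} [Field K] [CommGroup Γ] [Group.FG Γ] [Finite S]
    (c : FloerNovikov.FloerNovikovComplex K Γ P S)
    (hinj : Set.InjOn c.ω (c.deg.ker : Set Γ)) (k : ℤ) :
    c.boundaryDepth (k - 1) = c.opposite.boundaryDepth (-k) ∧
    c.opposite.boundaryDepth (-k) =
      -sInf ({0} ∪ {r : EReal | ∃ (x : c.opposite.boundaries (-k + 1)) (y : c.boundaries k),
        c.linkingForm k x y ≠ 0 ∧ r = c.level y.1 + c.opposite.level x.1}) ∧
    c.boundaryDepth (k - 1) ≠ ⊤ := by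
  classical
  have hk : k = k - 1 + 1 := (sub_add_cancel k 1).symm
  obtain ⟨G, lift, hchart⟩ := FloerNovikov.exists_chart c.toBase hinj
  obtain ⟨I, _, ⟨φ⟩⟩ := hchart k
  obtain ⟨J, _, ⟨ψ⟩⟩ := hchart (k - 1)
  obtain ⟨B, hB, hl, hr, hw⟩ := FloerNovikov.exists_common_boundedLift
    ((FloerNovikov.expValuation G K).comap (FloerNovikov.novikovField G K).subtype)
    (fun i => FloerNovikov.expNN_pos (φ.height i)) (fun j => FloerNovikov.expNN_pos (ψ.height j))
    (c.bdMatrix φ ψ)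
  obtain ⟨b, rfl⟩ := FloerNovikov.exists_expNN_eq (one_pos.trans_le hB)
  have hb : 0 ≤ b := by rwa [← FloerNovikov.expNN_zero, FloerNovikov.expNN_le_expNN] at hB
  have h1 : c.boundaryDepth (k - 1) ≤ b := c.boundaryDepth_le φ ψ hk hb hl
  have h2 : c.opposite.boundaryDepth (-k) ≤ b := by
    refine c.opposite.boundaryDepth_le (FloerNovikov.Chart.op ψ) (FloerNovikov.Chart.op φ)
      (by omega) hb ?_
    rw [c.bdMatrix_opposite]
    -- The opposite charts have negated heights, hence inverted weights.
    convert hr using 2 with j i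
    · exact FloerNovikov.expNN_neg _
    · exact FloerNovikov.expNN_neg _
  set T : Set EReal := {r : EReal | ∃ (x : c.opposite.boundaries (-k + 1)) (y : c.boundaries k),
    c.linkingForm k x y ≠ 0 ∧ r = c.level y.1 + c.opposite.level x.1}
  have h3 : -sInf ({0} ∪ T) ≤ c.boundaryDepth (k - 1) := by
    rw [EReal.neg_le]
    refine le_sInf ?_
    rintro r (rfl | ⟨x, y, hxy, rfl⟩)
    · rw [EReal.neg_le, neg_zero]
      exact c.boundaryDepth_nonneg _
    · exact c.neg_boundaryDepth_le hk x y hxy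
  have h4 : -sInf ({0} ∪ T) ≤ c.opposite.boundaryDepth (-k) := by
    rw [EReal.neg_le]
    refine le_sInf ?_
    rintro r (rfl | ⟨x, y, hxy, rfl⟩)
    · rw [EReal.neg_le, neg_zero]
      exact c.opposite.boundaryDepth_nonneg _
    · exact c.neg_boundaryDepth_opposite_le x y hxy
  have h5 : (b : EReal) ≤ -sInf ({0} ∪ T) := by
    rw [EReal.le_neg]
    -- If `B = 1` then `b = 0`, and the element `0` of the set is the witness; otherwise the
    -- elimination supplies a linked pair.
    rcases hw with hw | ⟨x, w, C, D, hxw, hC, hD, hCD⟩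
    · rw [← FloerNovikov.expNN_zero] at hw
      have hb0 : b ≤ 0 := FloerNovikov.expNN_le_expNN.1 hw.le
      rw [le_antisymm hb0 hb, EReal.coe_zero, neg_zero]
      exact sInf_le (Or.inl rfl)
    · obtain ⟨x', y', hne, hle⟩ := c.exists_linkingForm_ne_zero φ ψ hk hxw hC hD hCD
      rw [EReal.coe_neg] at hle
      have hmem : c.level y'.1 + c.opposite.level x'.1 ∈ ({0} ∪ T : Set EReal) :=
        Set.mem_union_right _ ⟨x', y', hne, rfl⟩
      exact (sInf_le hmem).trans hle
  have h6 : c.boundaryDepth (k - 1) = b := le_antisymm h1 (h5.trans h3)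
  have h7 : c.opposite.boundaryDepth (-k) = b := le_antisymm h2 (h5.trans h4)
  refine ⟨h6.trans h7.symm, h7.trans (le_antisymm h5 (h3.trans h1)), ?_⟩
  rw [h6]
  exact EReal.coe_ne_top b
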